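/- Let $X_m(k)$ ($m\ge 0$, $k\ge 1$) be independent random variables on a probability space $(\Omega,\mathcal F,\mathbf P)$ with $\mathbf P(X_m(k)=1)=\mathbf P(X_m(k)=-1)=\tfrac12$, and put $S_m(0)=0$, $S_m(n)=\sum_{k=1}^n X_m(k)$. For $m\ge1$ let $T_m(0)=0$ and $T_m(k+1)=\min\{n>T_m(k): |S_m(n)-S_m(T_m(k))|=2\}$ ($k\ge0$), which is almost surely well defined. Define $\tilde X_m(n)$ ($n\ge1$) recursively by $\tilde X_0(n)=X_0(n)$ and, for $m\ge 1$ and $T_m(k)<n\le T_m(k+1)$, $$\tilde X_m(n)=\begin{cases} X_m(n) & \text{if } S_m(T_m(k+1))-S_m(T_m(k))=2\tilde X_{m-1}(k+1),\\ -X_m(n) & \text{otherwise.}\end{cases}$$ Let $\tilde S_m(0)=0$, $\tilde S_m(n)=\sum_{k=1}^n\tilde X_m(k)$, extend $\tilde S_m$ to real $t\ge0$ by linear interpolation, and let $\tilde B_m(t)=2^{-m}\tilde S_m(t2^{2m})$ for $t\ge0$. Write $K_*=\max\{1,K\}$ and $\log_*K=\max\{1,\log K\}$. Then, almost surely, the sequence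 $(\tilde B_m)_{m\ge 0}$ converges uniformly on every bounded interval $[0,K]$ as $m\to\infty$, and the limit process $W$ is a standard Brownian motion. Moreover, for every $C>1$ there is a number $N_2(C)$, depending only on $C$, such that for all real $K>0$ and all integers $m\ge1$ with $K2^{2m}\ge N_2(C)$, $$\mathbf P\left(\sup_{0\le t\le K}|W(t)-\tilde B_m(t)|\ge 27\,C\,K_*^{1/4}(\log_*K)^{3/4}\,m^{3/4}\,2^{-m/2}\right)\le \frac{6}{1-4^{1-C}}\,(K2^{2m})^{1-C}.$$ -/

import Mathlib

open MeasureTheory ProbabilityTheory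
open scoped NNReal

universe u

namespace TwistShrink

/-- The matrix `X m k` (`m ≥ 0`, `k ≥ 1`) consists of independent random variables, each taking
the values `1` and `-1` with probability `1/2`. Nothing is said about the unused entries
`X m 0`. -/
structure IsSignMatrix {Ω : Type u} [MeasurableSpace Ω] (P : Measure Ω)
    (X : ℕ → ℕ → Ω → ℝ) : Prop where
  measurable : ∀ m k, 1 ≤ k → Measurable (X m k)
  prob_one : ∀ m k, 1 ≤ k → P {ω | X m k ω = 1} = 1 / 2
  prob_neg_one : ∀ m k, 1 ≤ k → P {ω | X m k ω = -1} = 1 / 2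
  indep : iIndepFun (fun p : ℕ × ℕ => X p.1 (p.2 + 1)) P

/-- The walk `S(n) = x 1 + ⋯ + x n` with steps `x 1, x 2, …`. -/
noncomputable def walk (x : ℕ → ℝ) (n : ℕ) : ℝ := ∑ k ∈ Finset.Icc 1 n, x k

/-- The times `T(0) = 0`, `T(k+1) = min {n > T(k) : |S(n) - S(T(k))| = 2}` of the walk `S` with
steps `x`. For the simple symmetric random walk the minimum exists almost surely. -/
noncomputable def stopTime (x : ℕ → ℝ) : ℕ → ℕ
  | 0 => 0
  | k + 1 => sInf {n | stopTime x k < n ∧ |walk x n - walk x (stopTime x k)| = 2}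

/-- The index `k` of the bridge containing the step `n ≥ 1`: `T(k) < n ≤ T(k+1)`. -/
noncomputable def bridge (x : ℕ → ℝ) (n : ℕ) : ℕ :=
  sInf {k | stopTime x k < n ∧ n ≤ stopTime x (k + 1)}

open Classical in
/-- The steps of the twisted walks, built from the steps `x m n` of the original walks: a bridge
of the `(m+1)`-st walk is flipped if its increment differs from twice the corresponding step of
the `m`-th twisted walk. -/
noncomputable def twistedStep (x : ℕ → ℕ → ℝ) : ℕ → ℕ → ℝ
  | 0, n => x 0 n
  | m + 1, n =>
    let k := bridge (x (m + 1)) n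
    if walk (x (m + 1)) (stopTime (x (m + 1)) (k + 1))
        - walk (x (m + 1)) (stopTime (x (m + 1)) k) = 2 * twistedStep x m (k + 1)
    then x (m + 1) n else -x (m + 1) n

/-- Linear interpolation of a sequence to real times `t ≥ 0`. -/
noncomputable def interp (s : ℕ → ℝ) (t : ℝ) : ℝ :=
  s ⌊t⌋₊ + (t - ⌊t⌋₊) * (s (⌊t⌋₊ + 1) - s ⌊t⌋₊)

/-- The `m`-th approximation `2⁻ᵐ S̃ₘ(t 2²ᵐ)` obtained by twisting and shrinking, for the random
steps `X m k ω`. -/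
noncomputable def approx {Ω : Type u} (X : ℕ → ℕ → Ω → ℝ) (m : ℕ) (t : ℝ≥0) (ω : Ω) : ℝ :=
  ((2 : ℝ) ^ m)⁻¹ *
    interp (walk (twistedStep (fun i k => X i k ω) m)) ((t : ℝ) * (2 : ℝ) ^ (2 * m))

/-- `log_* x = max {1, log x}`. -/
noncomputable def logStar (x : ℝ) : ℝ := max 1 (Real.log x)

end TwistShrink

/-! ### Bridges of a fixed sign sequence, and the twisting of one sequence by another. -/

namespace TwistShrink

/-! Group the steps of a walk into consecutive pairs. Started at an even time, the walk first moves
by 2 exactly at the end of the first pair with equal steps (`isLeast_bridge_end`). Hence the number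
of completed bridges after `n` pairs is `(n + R n) / 2`, where `R` is the walk of the pair products
(`two_mul_doubledCount`). The products are again independent fair signs
(`exists_measurePreserving_pairProd`), so Hoeffding's inequality keeps `T(k)` within order `√(N log
N)` of `4k` for `k ≤ N`.

Twisting makes the finer walk at time `T(k)` equal to twice the coarser walk at time `k`
(`Regular.walk_twist`). The twisted walk is itself a simple random walk (`measurePreserving_twist`),
so Hoeffding also bounds its oscillation over windows of that length around `4k`, by order `N^(1/4)
(log N)^(3/4)`. The two bad events are combined by a union bound, so their dependence does not
matter (`IsSignMatrix.tail_step`).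

With `N = K 4^n` and space scale `2^(-n-1)`, consecutive approximations differ on `[0, K]` by order
`2^(-n/2)` up to logarithmic factors, outside an event of probability at most `2 N^(1-C)`. Both
bounds are summable in `n`. The distances sum to less than `27 C K_*^(1/4) ⋯ 2^(-m/2)`
(`stepBound_le`) and the probabilities form a geometric series of ratio `4^(1-C)`. This gives the
convergence, the continuity of the limit and the tail bound, with 2 in place of 6.

For the law of the limit, increments of a sign walk over disjoint blocks have a product of powers of
cosines as joint characteristic function. In the limit this becomes a product of Gaussian
characteristic functions (`IsSignMatrix.integral_exp_increments`), which gives both the independence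
and the laws of the increments. -/

/-- The sequence `x 1, x 2, …` with `x (n + 1) = s n`. -/
def pad (s : ℕ → ℝ) (n : ℕ) : ℝ := s (n - 1)

@[simp] lemma pad_succ (s : ℕ → ℝ) (n : ℕ) : pad s (n + 1) = s n := rfl

lemma walk_congr {x y : ℕ → ℝ} (h : ∀ n, 1 ≤ n → x n = y n) : walk x = walk y := by
  funext n
  exact Finset.sum_congr rfl fun k hk => h k (Finset.mem_Icc.1 hk).1

lemma stopTime_congr {x y : ℕ → ℝ} (h : ∀ n, 1 ≤ n → x n = y n) : stopTime x = stopTime y := by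
  funext k
  induction k with
  | zero => rfl
  | succ k ih => rw [stopTime, stopTime, ih, walk_congr h]

lemma bridge_congr {x y : ℕ → ℝ} (h : ∀ n, 1 ≤ n → x n = y n) : bridge x = bridge y := by
  funext n
  rw [bridge, bridge, stopTime_congr h]

@[simp] lemma walk_zero (x : ℕ → ℝ) : walk x 0 = 0 := by simp [walk]

lemma walk_succ (x : ℕ → ℝ) (n : ℕ) : walk x (n + 1) = walk x n + x (n + 1) := by
  rw [walk, walk, Finset.sum_Icc_succ_top (by omega)]

lemma walk_pad (s : ℕ → ℝ) (n : ℕ) : walk (pad s) n = ∑ i ∈ Finset.range n, s i := by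
  induction n with
  | zero => simp
  | succ n ih => rw [walk_succ, ih, Finset.sum_range_succ, pad_succ]

/-- All terms are `1` or `-1`. -/
def IsSigns (s : ℕ → ℝ) : Prop := ∀ n, s n = 1 ∨ s n = -1

/-- The steps `2 j + 1` and `2 j + 2` of the walk agree. -/
def Doubled (s : ℕ → ℝ) (j : ℕ) : Prop := s (2 * j) = s (2 * j + 1)

noncomputable instance (s : ℕ → ℝ) : DecidablePred (Doubled s) := Classical.decPred _

/-- The number of doubled pairs of steps up to time `2 n`. -/
noncomputable def doubledCount (s : ℕ → ℝ) (n : ℕ) : ℕ := Nat.count (Doubled s) n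

/-- A sequence of signs with infinitely many doubled pairs. -/
structure Regular (s : ℕ → ℝ) : Prop where
  signs : IsSigns s
  infinite : (Set.ofPred (Doubled s)).Infinite

lemma IsSigns.add_eq_zero {s : ℕ → ℝ} (hs : IsSigns s) {j : ℕ} (h : ¬ Doubled s j) :
    s (2 * j) + s (2 * j + 1) = 0 := by
  unfold Doubled at h
  rcases hs (2 * j) with h1 | h1 <;> rcases hs (2 * j + 1) with h2 | h2 <;> simp_all

lemma walk_even_eq {s : ℕ → ℝ} (hs : IsSigns s) {a b : ℕ} (hab : a ≤ b)
    (h : ∀ j, a ≤ j → j < b → ¬ Doubled s j) : walk (pad s) (2 * b) = walk (pad s) (2 * a) := by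
  induction b, hab using Nat.le_induction with
  | base => rfl
  | succ b hab ih =>
    have h1 := ih fun j hj hjb => h j hj (by omega)
    have h2 := hs.add_eq_zero (h b hab (by omega))
    rw [show 2 * (b + 1) = 2 * b + 1 + 1 by ring, walk_succ, walk_succ, h1]
    simp only [pad_succ]
    linarith

/-- The first doubled pair after an even time ends the bridge started at that time. -/
lemma isLeast_bridge_end {s : ℕ → ℝ} (hs : IsSigns s) {a b : ℕ} (hab : a ≤ b)
    (h : ∀ j, a ≤ j → j < b → ¬ Doubled s j) (hb : Doubled s b) :
    IsLeast {n | 2 * a < n ∧ |walk (pad s) n - walk (pad s) (2 * a)| = 2} (2 * (b + 1)) := by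
  have key := walk_even_eq hs hab h
  have hfst : ∀ c, walk (pad s) (2 * c + 1) = walk (pad s) (2 * c) + s (2 * c) := fun c => by
    rw [walk_succ, pad_succ]
  constructor
  · refine ⟨by omega, ?_⟩
    rw [show 2 * (b + 1) = 2 * b + 1 + 1 by ring, walk_succ, hfst, key, pad_succ, ← hb]
    rcases hs (2 * b) with h1 | h1 <;> rw [h1] <;> ring_nf <;> norm_num
  · rintro n ⟨hn, h2⟩
    by_contra hlt
    push Not at hlt
    rcases Nat.even_or_odd' n with ⟨c, rfl | rfl⟩
    · rw [walk_even_eq hs (show a ≤ c by omega) fun j hj hjc => h j hj (by omega)] at h2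
      norm_num at h2
    · rw [hfst, walk_even_eq hs (show a ≤ c by omega) fun j hj hjc => h j hj (by omega)] at h2
      rcases hs (2 * c) with h1 | h1 <;> rw [h1] at h2 <;> ring_nf at h2 <;> norm_num at h2

namespace Regular

variable {s : ℕ → ℝ}

/-- Every bridge starts at an even time, right after a doubled pair or at 0, so the next doubled
pair is the one that ends it. -/
lemma stopTime_succ (hs : Regular s) (k : ℕ) :
    stopTime (pad s) (k + 1) = 2 * (Nat.nth (Doubled s) k + 1) := by
  have hmem := Nat.nth_mem_of_infinite hs.infinite
  induction k with
  | zero =>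
    have := isLeast_bridge_end hs.signs (Nat.zero_le (Nat.nth (Doubled s) 0))
      (fun j _ hj hD => by
        have := Nat.count_monotone (Doubled s) (Nat.succ_le_of_lt hj)
        rw [Nat.count_nth_zero, Nat.count_succ, if_pos hD] at this
        omega) (hmem 0)
    exact this.csInf_eq
  | succ k ih =>
    have hlt : Nat.nth (Doubled s) k < Nat.nth (Doubled s) (k + 1) :=
      Nat.nth_strictMono hs.infinite (Nat.lt_succ_self k)
    have := isLeast_bridge_end hs.signs (Nat.succ_le_of_lt hlt)
      (fun j hj hjk hD => by
        have := Nat.le_nth_of_lt_nth_succ hjk hD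
        omega) (hmem (k + 1))
    rw [stopTime, ih]
    exact this.csInf_eq

lemma abs_bridge (hs : Regular s) (k : ℕ) :
    |walk (pad s) (stopTime (pad s) (k + 1)) - walk (pad s) (stopTime (pad s) k)| = 2 := by
  have hmem := Nat.nth_mem_of_infinite hs.infinite
  have hne : {n | stopTime (pad s) k < n ∧
      |walk (pad s) n - walk (pad s) (stopTime (pad s) k)| = 2}.Nonempty := by
    -- The infimum of the empty set is 0, whereas `stopTime_succ` gives a positive value.
    by_contra hne
    rw [Set.not_nonempty_iff_eq_empty] at hne
    have := hs.stopTime_succ k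
    rw [stopTime, hne, Nat.sInf_empty] at this
    omega
  exact (Nat.sInf_mem hne).2

/-- Stopping times and counts of doubled pairs are inverse to each other; this turns questions about
`stopTime` into questions about a sum. -/
lemma stopTime_le_two_mul_iff (hs : Regular s) (k n : ℕ) :
    stopTime (pad s) k ≤ 2 * n ↔ k ≤ doubledCount s n := by
  cases k with
  | zero => simp [stopTime]
  | succ k =>
    rw [hs.stopTime_succ, doubledCount, Nat.succ_le_iff, ← not_iff_not, not_lt,
      Nat.count_le_iff_le_nth hs.infinite]
    omega

lemma exists_stopTime_eq (hs : Regular s) (k : ℕ) :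
    ∃ n, stopTime (pad s) k = 2 * n ∧ doubledCount s n = k := by
  cases k with
  | zero => exact ⟨0, rfl, by simp [doubledCount]⟩
  | succ k =>
    refine ⟨_, hs.stopTime_succ k, ?_⟩
    rw [doubledCount, Nat.count_succ, Nat.count_nth_of_infinite hs.infinite,
      if_pos (Nat.nth_mem_of_infinite hs.infinite k)]

lemma stopTime_lt_iff (hs : Regular s) (k n : ℕ) :
    stopTime (pad s) k < n + 1 ↔ k ≤ doubledCount s (n / 2) := by
  obtain ⟨a, ha, -⟩ := hs.exists_stopTime_eq k
  rw [← hs.stopTime_le_two_mul_iff, ha]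
  omega

lemma stopTime_mono (hs : Regular s) : Monotone (stopTime (pad s)) := by
  refine monotone_nat_of_le_succ fun k => ?_
  obtain ⟨a, ha, hk⟩ := hs.exists_stopTime_eq (k + 1)
  rw [ha, hs.stopTime_le_two_mul_iff]
  omega

/-- The bridge containing a step is determined by the complete pairs before that step. This is what
makes a bridgewise change of sign predictable. -/
lemma bridge_eq (hs : Regular s) (n : ℕ) :
    bridge (pad s) (n + 1) = doubledCount s (n / 2) := by
  refine IsLeast.csInf_eq ⟨⟨(hs.stopTime_lt_iff _ n).2 le_rfl, ?_⟩, ?_⟩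
  · by_contra h
    have := (hs.stopTime_lt_iff _ n).1 (not_le.1 h)
    omega
  · rintro k ⟨-, hk⟩
    by_contra h
    have := (hs.stopTime_lt_iff (k + 1) n).2 (by omega)
    omega

lemma bridge_eq_of_mem (hs : Regular s) {k n : ℕ} (h1 : stopTime (pad s) k < n + 1)
    (h2 : n + 1 ≤ stopTime (pad s) (k + 1)) : bridge (pad s) (n + 1) = k := by
  rw [hs.bridge_eq]
  have := (hs.stopTime_lt_iff k n).1 h1
  have h3 := mt (hs.stopTime_lt_iff (k + 1) n).2 (by omega)
  omega

end Regular

/-- The product of the steps `2 j + 1` and `2 j + 2`. -/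
def pairProd (s : ℕ → ℝ) (j : ℕ) : ℝ := s (2 * j) * s (2 * j + 1)

/-- The pair product is 1 on doubled pairs and -1 on the others. -/
lemma two_mul_doubledCount {s : ℕ → ℝ} (hs : IsSigns s) (n : ℕ) :
    2 * (doubledCount s n : ℝ) = n + ∑ j ∈ Finset.range n, pairProd s j := by
  induction n with
  | zero => simp [doubledCount]
  | succ n ih =>
    rw [doubledCount, Nat.count_succ, Finset.sum_range_succ]
    rw [doubledCount] at ih
    push_cast
    rw [mul_add, ih]
    have key : pairProd s n = if Doubled s n then 1 else -1 := by
      have hD : Doubled s n ↔ s (2 * n) = s (2 * n + 1) := Iff.rfl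
      rw [pairProd]
      rcases hs (2 * n) with h1 | h1 <;> rcases hs (2 * n + 1) with h2 | h2 <;>
        rw [h1, h2] at hD ⊢ <;> norm_num at hD <;> simp [hD]
    rw [key]
    split_ifs <;> norm_num <;> ring

/-- The stopping times are close to their means when the walk of the pair products is small. -/
lemma Regular.abs_stopTime_sub_le {s : ℕ → ℝ} (hs : Regular s) {a : ℝ} {J : ℕ}
    (hR : ∀ n ≤ J, |∑ j ∈ Finset.range n, pairProd s j| ≤ a) {k : ℕ} (hk : 2 * (k : ℝ) + a ≤ J) :
    |(stopTime (pad s) k : ℝ) - 4 * k| ≤ 2 * a := by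
  obtain ⟨n, hn, hc⟩ := hs.exists_stopTime_eq k
  -- By `hk` at least `k` doubled pairs occur among the first `J`, so `T(k) = 2n` falls in the range
  -- where `hR` applies.
  have hJ : n ≤ J := by
    have h1 : stopTime (pad s) k ≤ 2 * J := by
      rw [hs.stopTime_le_two_mul_iff]
      have h2 := two_mul_doubledCount hs.signs J
      have h3 := (abs_le.1 (hR J le_rfl)).1
      have : (k : ℝ) ≤ doubledCount s J := by linarith
      exact_mod_cast this
    omega
  have h2 := two_mul_doubledCount hs.signs n
  have h3 := hR n hJ
  rw [hc] at h2
  rw [hn]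
  push_cast
  have : (2 * n - 4 * k : ℝ) = -2 * ∑ j ∈ Finset.range n, pairProd s j := by linarith
  rw [this, abs_mul]
  norm_num
  linarith

/-- One step of the twisting procedure, for steps numbered from `0`: the bridges of `s` are
flipped so that their increments become `2 * y 0, 2 * y 1, …`. -/
noncomputable def twist (s y : ℕ → ℝ) (n : ℕ) : ℝ :=
  let k := bridge (pad s) (n + 1)
  if walk (pad s) (stopTime (pad s) (k + 1)) - walk (pad s) (stopTime (pad s) k) = 2 * y k
  then s n else -s n

lemma twistedStep_succ_succ (x : ℕ → ℕ → ℝ) (m n : ℕ) :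
    twistedStep x (m + 1) (n + 1) =
      twist (fun k => x (m + 1) (k + 1)) (fun k => twistedStep x m (k + 1)) n := by
  -- The two sequences may differ at index 0, which walks, stopping times and bridges never read.
  have h : ∀ n, 1 ≤ n → x (m + 1) n = pad (fun k => x (m + 1) (k + 1)) n := fun n hn => by
    rw [pad, Nat.sub_add_cancel hn]
  simp only [twistedStep, twist, walk_congr h, stopTime_congr h, bridge_congr h]

lemma IsSigns.twist {s y : ℕ → ℝ} (hs : IsSigns s) : IsSigns (twist s y) := fun n => by
  unfold TwistShrink.twist
  rcases hs n with h | h <;> simp only [h] <;> split_ifs <;> norm_num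

/-- The increment of the twisted walk over the `k`-th bridge. -/
lemma Regular.walk_twist_sub {s y : ℕ → ℝ} (hs : Regular s) (hy : IsSigns y) (k : ℕ) :
    walk (pad (twist s y)) (stopTime (pad s) (k + 1)) - walk (pad (twist s y)) (stopTime (pad s) k)
      = 2 * y k := by
  have hmono := hs.stopTime_mono (Nat.le_succ k)
  have hinc : ∀ z : ℕ → ℝ, walk (pad z) (stopTime (pad s) (k + 1)) -
      walk (pad z) (stopTime (pad s) k) =
      ∑ i ∈ Finset.Ico (stopTime (pad s) k) (stopTime (pad s) (k + 1)), z i := fun z => by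
    rw [walk_pad, walk_pad, Finset.sum_Ico_eq_sub _ hmono]
  have hbr : ∀ i ∈ Finset.Ico (stopTime (pad s) k) (stopTime (pad s) (k + 1)),
      bridge (pad s) (i + 1) = k := fun i hi => by
    rw [Finset.mem_Ico] at hi
    exact hs.bridge_eq_of_mem (by omega) (by omega)
  have habs := hs.abs_bridge k
  by_cases h : walk (pad s) (stopTime (pad s) (k + 1)) - walk (pad s) (stopTime (pad s) k) = 2 * y k
  · rw [← h, hinc, hinc]
    refine Finset.sum_congr rfl fun i hi => ?_
    simp only [twist, hbr i hi, if_pos h]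
  · have h' : walk (pad (twist s y)) (stopTime (pad s) (k + 1)) -
        walk (pad (twist s y)) (stopTime (pad s) k) =
        -(walk (pad s) (stopTime (pad s) (k + 1)) - walk (pad s) (stopTime (pad s) k)) := by
      rw [hinc, hinc, ← Finset.sum_neg_distrib]
      refine Finset.sum_congr rfl fun i hi => ?_
      simp only [twist, hbr i hi, if_neg h]
    rw [h']
    rcases eq_or_eq_neg_of_abs_eq habs with h2 | h2 <;> rcases hy k with h3 | h3 <;>
      first
      | (rw [h2, h3]; norm_num; done)
      | (exfalso; apply h; rw [h2, h3]; norm_num)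

/-- Refinement property: sampled at the stopping times, the twisted walk reproduces the coarser walk
on twice the scale. -/
lemma Regular.walk_twist {s y : ℕ → ℝ} (hs : Regular s) (hy : IsSigns y) (k : ℕ) :
    walk (pad (twist s y)) (stopTime (pad s) k) = 2 * walk (pad y) k := by
  induction k with
  | zero => simp [stopTime]
  | succ k ih =>
    have := hs.walk_twist_sub hy k
    rw [walk_succ, pad_succ]
    linarith

end TwistShrink

/-! ### The law of independent fair signs and its invariance under predictable changes of sign. -/

namespace TwistShrink

open scoped ENNReal

/-- The uniform distribution on `{1, -1}`. -/
noncomputable def signMeasure : Measure ℝ :=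
  (1 / 2 : ℝ≥0∞) • Measure.dirac 1 + (1 / 2 : ℝ≥0∞) • Measure.dirac (-1)

instance : IsProbabilityMeasure signMeasure :=
  ⟨by simp [signMeasure, ENNReal.inv_two_add_inv_two]⟩

lemma lintegral_signMeasure (f : ℝ → ℝ≥0∞) :
    ∫⁻ x, f x ∂signMeasure = 1 / 2 * f 1 + 1 / 2 * f (-1) := by
  simp [signMeasure]

lemma ae_signMeasure : ∀ᵐ x ∂signMeasure, x = 1 ∨ x = -1 := by
  rw [ae_iff]
  simp [signMeasure, Measure.add_apply]

lemma integral_signMeasure (f : ℝ → ℂ) :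
    ∫ x, f x ∂signMeasure = (f 1 + f (-1)) / 2 := by
  rw [signMeasure, integral_add_measure, integral_smul_measure, integral_smul_measure]
  · simp; ring
  all_goals exact (integrable_dirac (by simp)).smul_measure (by simp)

/-- The law of a sequence of independent uniform signs. -/
noncomputable def coinMeasure : Measure (ℕ → ℝ) := Measure.infinitePi fun _ => signMeasure

instance : IsProbabilityMeasure coinMeasure := by unfold coinMeasure; infer_instance

lemma measurePreserving_eval_coin (n : ℕ) :
    MeasurePreserving (fun s : ℕ → ℝ => s n) coinMeasure signMeasure :=
  measurePreserving_eval_infinitePi (fun _ => signMeasure) n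

lemma ae_isSigns : ∀ᵐ s ∂coinMeasure, IsSigns s :=
  ae_all_iff.2 fun n =>
    (measurePreserving_eval_coin n).quasiMeasurePreserving.ae ae_signMeasure

lemma iIndepFun_coin : iIndepFun (fun (n : ℕ) (s : ℕ → ℝ) => s n) coinMeasure :=
  iIndepFun_infinitePi (X := fun _ x => x) fun _ => measurable_id

/-- The first `n` terms of a sequence, followed by zeros. -/
def trunc (n : ℕ) (s : ℕ → ℝ) (i : ℕ) : ℝ := if i < n then s i else 0

lemma measurable_trunc (n : ℕ) : Measurable (trunc n) := by
  refine measurable_pi_lambda _ fun i => ?_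
  unfold trunc
  split_ifs <;> fun_prop

/-- The past is encoded as a full sequence padded by zeros, so that predictability becomes the
equation `h n (trunc n s) = h n s`. -/
lemma indepFun_trunc (n : ℕ) : IndepFun (trunc n) (fun s : ℕ → ℝ => s n) coinMeasure := by
  have h := iIndepFun_coin.indepFun_finset (Finset.range n) {n} (by simp) fun i => by fun_prop
  have hφ : Measurable fun (v : Finset.range n → ℝ) (i : ℕ) =>
      if h : i ∈ Finset.range n then v ⟨i, h⟩ else (0 : ℝ) := by
    refine measurable_pi_lambda _ fun i => ?_
    split_ifs <;> fun_prop
  have hψ : Measurable fun v : ({n} : Finset ℕ) → ℝ => v ⟨n, by simp⟩ := by fun_prop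
  convert! h.comp hφ hψ using 1
  funext s i
  simp [trunc]

/-- Multiplying each term by a sign that is a function of the previous terms preserves the law
of a sequence of independent uniform signs. -/
theorem measurePreserving_mul_predictable {h : ℕ → (ℕ → ℝ) → ℝ} (hm : ∀ n, Measurable (h n))
    (hs : ∀ n s, h n s = 1 ∨ h n s = -1) (hp : ∀ n s, h n (trunc n s) = h n s) :
    MeasurePreserving (fun s n => s n * h n s) coinMeasure coinMeasure := by
  have hmeas : Measurable fun (s : ℕ → ℝ) n => s n * h n s :=
    measurable_pi_lambda _ fun n => (measurable_pi_apply n).mul (hm n)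
  have htt : ∀ (m n : ℕ) (s : ℕ → ℝ), m ≤ n → trunc m (trunc n s) = trunc m s := by
    intro m n s hmn
    funext i
    simp only [trunc]
    split_ifs <;> first | rfl | omega
  -- Product test functions determine the law. In the induction the integral is split by the value
  -- of `h n s`; on each piece the past and `s n` are independent, and the symmetry of `signMeasure`
  -- absorbs the sign.
  have key : ∀ (f : ℕ → ℝ → ℝ≥0∞), (∀ i, Measurable (f i)) → ∀ n,
      ∫⁻ s, ∏ i ∈ Finset.range n, f i (s i * h i s) ∂coinMeasure =
        ∏ i ∈ Finset.range n, ∫⁻ x, f i x ∂signMeasure := by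
    intro f hf n
    induction n with
    | zero => simp
    | succ n ih =>
      set A : (ℕ → ℝ) → ℝ≥0∞ := fun s => ∏ i ∈ Finset.range n, f i (s i * h i s) with hA
      have hAm : Measurable A := by
        refine Finset.measurable_prod _ fun i _ => (hf i).comp ?_
        exact (measurable_pi_apply i).mul (hm i)
      have hAt : ∀ s, A (trunc n s) = A s := by
        intro s
        refine Finset.prod_congr rfl fun i hi => ?_
        rw [Finset.mem_range] at hi
        rw [← hp i (trunc n s), htt i n s hi.le, hp i s]
        simp [trunc, hi]
      have hmul : ∀ B : (ℕ → ℝ) → ℝ≥0∞, Measurable B → (∀ s, B (trunc n s) = B s) →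
          ∀ g : ℝ → ℝ≥0∞, Measurable g →
          ∫⁻ s, B s * g (s n) ∂coinMeasure =
            (∫⁻ s, B s ∂coinMeasure) * ∫⁻ x, g x ∂signMeasure := by
        intro B hB hBt g hg
        have hi : IndepFun (fun s => B (trunc n s)) (fun s : ℕ → ℝ => g (s n)) coinMeasure :=
          (indepFun_trunc n).comp hB hg
        have := lintegral_mul_eq_lintegral_mul_lintegral_of_indepFun
          (hB.comp (measurable_trunc n)) (hg.comp (measurable_pi_apply n)) hi
        simp only [Pi.mul_apply, Function.comp_def, hBt] at this
        rw [this, (measurePreserving_eval_coin n).lintegral_comp hg]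
      have hE : MeasurableSet {s | h n s = 1} := (hm n) (measurableSet_singleton 1)
      have hE' : MeasurableSet {s | h n s = -1} := (hm n) (measurableSet_singleton (-1))
      have hsplit : ∀ s, A s * f n (s n * h n s) =
          {s | h n s = 1}.indicator A s * f n (s n) +
            {s | h n s = -1}.indicator A s * f n (-s n) := by
        intro s
        rcases hs n s with h1 | h1 <;> simp [Set.indicator, h1] <;> norm_num
      have hsplit' : ∀ s, A s = {s | h n s = 1}.indicator A s + {s | h n s = -1}.indicator A s := by
        intro s
        rcases hs n s with h1 | h1 <;> simp [Set.indicator, h1] <;> norm_num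
      have hind : ∀ e : ℝ, ∀ s, {s | h n s = e}.indicator A (trunc n s) =
          {s | h n s = e}.indicator A s := by
        intro e s
        simp only [Set.indicator, Set.mem_ofPred_eq, hp, hAt]
      have hneg : ∫⁻ x, f n (-x) ∂signMeasure = ∫⁻ x, f n x ∂signMeasure := by
        rw [lintegral_signMeasure, lintegral_signMeasure, neg_neg, add_comm]
      simp only [Finset.prod_range_succ]
      rw [← ih]
      change ∫⁻ s, A s * f n (s n * h n s) ∂coinMeasure = (∫⁻ s, A s ∂coinMeasure) * _
      have hAf : Measurable fun s => {s | h n s = 1}.indicator A s * f n (s n) :=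
        (hAm.indicator hE).mul ((hf n).comp (measurable_pi_apply n))
      rw [lintegral_congr hsplit, lintegral_congr hsplit', lintegral_add_left hAf,
        hmul _ (hAm.indicator hE) (hind 1) _ (hf n),
        hmul _ (hAm.indicator hE') (hind (-1)) (fun x => f n (-x)) ((hf n).comp measurable_neg),
        hneg, ← add_mul, ← lintegral_add_left (hAm.indicator hE)]
  -- It suffices to compare finite cylinders; coordinates outside `S` receive the test function 1.
  refine ⟨hmeas, Measure.eq_infinitePi _ fun S t ht => ?_⟩
  obtain ⟨n, hn⟩ := S.exists_nat_subset_range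
  classical
  rw [Measure.map_apply hmeas (MeasurableSet.pi S.countable_toSet fun i _ => ht i),
    ← lintegral_indicator_one
      (hmeas (MeasurableSet.pi S.countable_toSet fun i _ => ht i))]
  have h1 := key (fun i => if i ∈ S then (t i).indicator 1 else 1) (fun i => by
    split_ifs
    · exact measurable_one.indicator (ht i)
    · exact measurable_one) n
  have h2 : ∀ s : ℕ → ℝ, ((fun (s : ℕ → ℝ) n => s n * h n s) ⁻¹' (Set.pi S t)).indicator
      (1 : (ℕ → ℝ) → ℝ≥0∞) s = ∏ i ∈ Finset.range n,
        (if i ∈ S then (t i).indicator (1 : ℝ → ℝ≥0∞) else 1) (s i * h i s) := by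
    intro s
    rw [← Finset.prod_subset hn fun i _ hi => by simp [hi]]
    by_cases hmem : ∀ i ∈ S, s i * h i s ∈ t i
    · rw [Set.indicator_of_mem (by simpa [Set.mem_pi] using hmem)]
      symm
      exact Finset.prod_eq_one fun i hi => by simp [hi, hmem i hi]
    · rw [Set.indicator_of_notMem (by simpa [Set.mem_pi] using hmem)]
      push Not at hmem
      obtain ⟨i, hi, hit⟩ := hmem
      exact (Finset.prod_eq_zero hi (by simp [hi, hit])).symm
  rw [lintegral_congr h2, h1, ← Finset.prod_subset hn fun i _ hi => by simp [hi]]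
  refine Finset.prod_congr rfl fun i hi => ?_
  rw [if_pos hi, lintegral_indicator_one (ht i)]

end TwistShrink

namespace TwistShrink

/-! ### Deviation of sums of signs -/

lemma hasSubgaussianMGF_coin (n : ℕ) :
    HasSubgaussianMGF (fun s : ℕ → ℝ => s n) 1 coinMeasure := by
  have hb : ∀ᵐ s ∂coinMeasure, s n ∈ Set.Icc (-1 : ℝ) 1 := by
    filter_upwards [ae_isSigns] with s hs
    rcases hs n with h | h <;> rw [h] <;> norm_num
  have h0 : ∫ s, s n ∂coinMeasure = 0 := by
    have h1 : ∫ x : ℝ, x ∂signMeasure = 0 := by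
      rw [signMeasure, integral_add_measure, integral_smul_measure, integral_smul_measure]
      · simp
      all_goals exact (integrable_dirac (by simp)).smul_measure (by simp)
    have h2 := (measurePreserving_eval_coin n).map_eq
    rw [← h1, ← h2, integral_map (measurable_pi_apply n).aemeasurable (by fun_prop)]
  have := hasSubgaussianMGF_of_mem_Icc_of_integral_eq_zero
    (measurable_pi_apply n).aemeasurable hb h0
  convert this using 1
  ext
  norm_num

/-- **Hoeffding's inequality** for sums of independent signs. -/
lemma coin_abs_sum_ge_le (F : Finset ℕ) {x : ℝ} (hx : 0 ≤ x) :
    coinMeasure.real {s | x ≤ |∑ i ∈ F, s i|} ≤ 2 * Real.exp (-x ^ 2 / (2 * F.card)) := by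
  have h1 := HasSubgaussianMGF.measure_sum_ge_le_of_iIndepFun iIndepFun_coin (s := F)
    (fun i _ => hasSubgaussianMGF_coin i) hx
  have h2 := HasSubgaussianMGF.measure_sum_ge_le_of_iIndepFun
    (X := fun (n : ℕ) (s : ℕ → ℝ) => -s n)
    (iIndepFun_coin.comp (fun _ x => -x) fun _ => measurable_neg) (s := F)
    (fun i _ => (hasSubgaussianMGF_coin i).neg) hx
  simp only [Finset.sum_const, nsmul_eq_mul, mul_one, NNReal.coe_natCast] at h1 h2
  calc coinMeasure.real {s | x ≤ |∑ i ∈ F, s i|}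
      ≤ coinMeasure.real ({s | x ≤ ∑ i ∈ F, s i} ∪ {s | x ≤ ∑ i ∈ F, -s i}) := by
        refine measureReal_mono fun s hs => ?_
        simp only [Set.mem_ofPred_eq, Set.mem_union, Finset.sum_neg_distrib] at hs ⊢
        exact le_abs.1 hs
    _ ≤ _ := (measureReal_union_le _ _).trans (by linarith)

/-- The products of disjoint pairs of independent signs are independent signs. -/
lemma exists_measurePreserving_pairProd : ∃ φ : (ℕ → ℝ) → ℕ → ℝ,
    MeasurePreserving φ coinMeasure coinMeasure ∧
      ∀ᵐ s ∂coinMeasure, ∀ j, φ s (2 * j + 1) = pairProd s j := by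
  -- Each odd-indexed step is multiplied by its predecessor. The `if` makes this a sign for every
  -- sequence, not just almost every one.
  let h : ℕ → (ℕ → ℝ) → ℝ := fun n s => if n % 2 = 0 then 1 else if s (n - 1) = 1 then 1 else -1
  refine ⟨_, measurePreserving_mul_predictable (h := h) ?_ ?_ ?_, ?_⟩
  · intro n
    simp only [h]
    split_ifs
    · exact measurable_const
    · exact Measurable.ite (measurable_pi_apply _ (measurableSet_singleton 1)) measurable_const
        measurable_const
  · intro n s
    simp only [h]
    split_ifs <;> simp
  · intro n s
    simp only [h, trunc]
    rcases n with _ | n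
    · simp
    · simp
  · filter_upwards [ae_isSigns] with s hs j
    have h1 : (2 * j + 1) % 2 ≠ 0 := by omega
    simp only [h, if_neg h1, pairProd, Nat.add_sub_cancel]
    rcases hs (2 * j) with h2 | h2 <;> rw [h2] <;> norm_num

lemma coin_abs_sum_pairProd_ge_le (F : Finset ℕ) {x : ℝ} (hx : 0 ≤ x) :
    coinMeasure.real {s | x ≤ |∑ j ∈ F, pairProd s j|} ≤ 2 * Real.exp (-x ^ 2 / (2 * F.card)) := by
  obtain ⟨φ, hφ, hφ'⟩ := exists_measurePreserving_pairProd
  have hinj : Function.Injective fun j : ℕ => 2 * j + 1 := fun a b h => by simpa using h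
  have h1 := coin_abs_sum_ge_le (F.map ⟨_, hinj⟩) hx
  simp only [Finset.sum_map, Function.Embedding.coeFn_mk, Finset.card_map] at h1
  refine le_trans (le_of_eq ?_) h1
  have hset : MeasurableSet {s : ℕ → ℝ | x ≤ |∑ j ∈ F, s (2 * j + 1)|} :=
    measurableSet_le measurable_const (by fun_prop)
  rw [← hφ.measureReal_preimage hset.nullMeasurableSet]
  refine measureReal_congr ?_
  filter_upwards [hφ'] with s hs
  change (x ≤ |∑ j ∈ F, pairProd s j|) = (x ≤ |∑ j ∈ F, φ s (2 * j + 1)|)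
  simp only [hs]

/-- If no pair from `a` on were doubled, `n` of the products would sum to `-n`, an event of
probability at most `2 exp(-n/2)` for every `n`. -/
lemma ae_regular : ∀ᵐ s ∂coinMeasure, Regular s := by
  have key : ∀ a : ℕ, ∀ᵐ s ∂coinMeasure, ¬ ∀ j, a ≤ j → pairProd s j = -1 := by
    intro a
    rw [ae_iff]
    simp only [not_not]
    rw [← measureReal_eq_zero_iff]
    refine le_antisymm ?_ measureReal_nonneg
    have hle : ∀ n : ℕ, coinMeasure.real {s | ∀ j, a ≤ j → pairProd s j = -1} ≤
        2 * Real.exp (-(n : ℝ) / 2) := by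
      intro n
      have h1 := coin_abs_sum_pairProd_ge_le (Finset.Ico a (a + n)) (Nat.cast_nonneg n)
      refine (measureReal_mono fun s hs => ?_).trans (h1.trans_eq ?_)
      · simp only [Set.mem_ofPred_eq] at hs ⊢
        rw [Finset.sum_congr rfl fun j hj => hs j (Finset.mem_Ico.1 hj).1]
        simp
      · rw [Nat.card_Ico, Nat.add_sub_cancel_left]
        rcases eq_or_ne (n : ℝ) 0 with h | h
        · simp [h]
        · congr 2
          field_simp
    have hlim : Filter.Tendsto (fun n : ℕ => 2 * Real.exp (-(n : ℝ) / 2)) Filter.atTop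
        (nhds (2 * 0)) := by
      refine Filter.Tendsto.const_mul 2 (Real.tendsto_exp_atBot.comp ?_)
      have : Filter.Tendsto (fun n : ℕ => (n : ℝ) / 2) Filter.atTop Filter.atTop :=
        tendsto_natCast_atTop_atTop.atTop_div_const (by norm_num)
      refine (Filter.tendsto_neg_atTop_atBot.comp this).congr fun n => ?_
      simp [neg_div]
    rw [mul_zero] at hlim
    exact ge_of_tendsto' hlim hle
  filter_upwards [ae_isSigns, ae_all_iff.2 key] with s hs hk
  refine ⟨hs, fun hfin => ?_⟩
  obtain ⟨a, ha⟩ := hfin.bddAbove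
  refine hk (a + 1) fun j hj => ?_
  have hD : ¬ Doubled s j := fun hD => by
    have := ha (show j ∈ Set.ofPred (Doubled s) from hD)
    omega
  unfold Doubled at hD
  rw [pairProd]
  rcases hs (2 * j) with h1 | h1 <;> rcases hs (2 * j + 1) with h2 | h2 <;>
    simp [h1, h2] at hD ⊢

/-! ### Measurability -/

lemma measurable_sInf_nat {α : Type*} [MeasurableSpace α] {p : α → ℕ → Prop}
    (hp : ∀ n, MeasurableSet {a | p a n}) : Measurable fun a => sInf {n | p a n} := by
  refine measurable_of_Iic fun n => ?_
  -- The second set collects the points where no index qualifies; there the infimum is 0 by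
  -- convention.
  have : (fun a => sInf {n | p a n}) ⁻¹' Set.Iic n =
      (⋃ j ∈ Set.Iic n, {a | p a j}) ∪ ⋂ j, {a | p a j}ᶜ := by
    ext a
    simp only [Set.mem_preimage, Set.mem_Iic, Set.mem_union, Set.mem_iUnion, Set.mem_ofPred_eq,
      Set.mem_iInter, Set.mem_compl_iff]
    constructor
    · intro h
      by_cases hne : {n | p a n}.Nonempty
      · exact Or.inl ⟨_, h, Nat.sInf_mem hne⟩
      · exact Or.inr fun j hj => hne ⟨j, hj⟩
    · rintro (⟨j, hj, hpj⟩ | h)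
      · exact (Nat.sInf_le hpj).trans hj
      · have : {n | p a n} = ∅ := Set.eq_empty_of_forall_notMem h
        simp [this]
  rw [this]
  exact (MeasurableSet.biUnion (Set.to_countable _) fun j _ => hp j).union
    (MeasurableSet.iInter fun j => (hp j).compl)

lemma measurable_comp_nat {α β : Type*} [MeasurableSpace α] [MeasurableSpace β] {f : ℕ → α → β}
    {g : α → ℕ} (hf : ∀ n, Measurable (f n)) (hg : Measurable g) :
    Measurable fun a => f (g a) a := by
  have : Measurable fun p : ℕ × α => f p.1 p.2 := measurable_from_prod_countable_right hf
  exact this.comp (hg.prodMk measurable_id)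

lemma measurable_walk_pad (n : ℕ) : Measurable fun s : ℕ → ℝ => walk (pad s) n := by
  simp only [walk_pad]
  fun_prop

lemma measurable_stopTime_pad (k : ℕ) : Measurable fun s : ℕ → ℝ => stopTime (pad s) k := by
  induction k with
  | zero => exact measurable_const
  | succ k ih =>
    refine measurable_sInf_nat fun n => ?_
    refine (measurableSet_lt ih measurable_const).inter ?_
    refine measurableSet_eq_fun ?_ measurable_const
    exact ((measurable_walk_pad n).sub (measurable_comp_nat measurable_walk_pad ih)).abs

lemma measurable_bridge_pad (n : ℕ) : Measurable fun s : ℕ → ℝ => bridge (pad s) n :=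
  measurable_sInf_nat fun k => (measurableSet_lt (measurable_stopTime_pad k) measurable_const).inter
    (measurableSet_le measurable_const (measurable_stopTime_pad (k + 1)))

/-- The increment of the walk over its `k`-th bridge. -/
noncomputable def bridgeIncr (s : ℕ → ℝ) (k : ℕ) : ℝ :=
  walk (pad s) (stopTime (pad s) (k + 1)) - walk (pad s) (stopTime (pad s) k)

lemma measurable_bridgeIncr (k : ℕ) : Measurable fun s : ℕ → ℝ => bridgeIncr s k :=
  (measurable_comp_nat measurable_walk_pad (measurable_stopTime_pad (k + 1))).sub
    (measurable_comp_nat measurable_walk_pad (measurable_stopTime_pad k))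

/-- The sign by which the `k`-th bridge is multiplied. -/
noncomputable def flipSign (s y : ℕ → ℝ) (k : ℕ) : ℝ := if bridgeIncr s k = 2 * y k then 1 else -1

lemma measurable_flipSign (k : ℕ) :
    Measurable fun p : (ℕ → ℝ) × (ℕ → ℝ) => flipSign p.1 p.2 k := by
  refine Measurable.ite (measurableSet_eq_fun ((measurable_bridgeIncr k).comp measurable_fst) ?_)
    measurable_const measurable_const
  fun_prop

lemma twist_eq (s y : ℕ → ℝ) (n : ℕ) :
    twist s y n = s n * flipSign s y (bridge (pad s) (n + 1)) := by
  by_cases h : bridgeIncr s (bridge (pad s) (n + 1)) = 2 * y (bridge (pad s) (n + 1))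
  · rw [flipSign, if_pos h, mul_one]
    exact if_pos h
  · rw [flipSign, if_neg h, mul_neg_one]
    exact if_neg h

lemma measurable_twist : Measurable fun p : (ℕ → ℝ) × (ℕ → ℝ) => twist p.1 p.2 := by
  refine measurable_pi_lambda _ fun n => ?_
  simp only [twist_eq]
  refine Measurable.mul (by fun_prop) ?_
  exact measurable_comp_nat measurable_flipSign
    ((measurable_bridge_pad (n + 1)).comp measurable_fst)

lemma measurableSet_doubled (j : ℕ) : MeasurableSet {s : ℕ → ℝ | Doubled s j} :=
  measurableSet_eq_fun (by fun_prop) (by fun_prop)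

lemma measurable_doubledCount (n : ℕ) : Measurable fun s : ℕ → ℝ => doubledCount s n := by
  induction n with
  | zero => simp [doubledCount]
  | succ n ih =>
    simp only [doubledCount, Nat.count_succ] at ih ⊢
    exact ih.add (Measurable.ite (measurableSet_doubled n) measurable_const measurable_const)

/-! ### The law of the twisted steps -/

/-- Multiplying the bridges of independent signs by a fixed sequence of signs yields independent
signs. -/
lemma measurePreserving_mul_bridge (σ : ℕ → ℝ) :
    MeasurePreserving (fun (s : ℕ → ℝ) n =>
      s n * if σ (doubledCount s (n / 2)) = 1 then (1 : ℝ) else -1) coinMeasure coinMeasure := by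
  refine measurePreserving_mul_predictable
    (h := fun n s => if σ (doubledCount s (n / 2)) = 1 then (1 : ℝ) else -1) ?_ ?_ ?_
  · intro n
    exact (measurable_from_top (f := fun k => if σ k = 1 then (1 : ℝ) else -1)).comp
      (measurable_doubledCount (n / 2))
  · intro n s
    split_ifs <;> simp
  · intro n s
    have : doubledCount (trunc n s) (n / 2) = doubledCount s (n / 2) := by
      rw [doubledCount, doubledCount, Nat.count_eq_card_filter_range, Nat.count_eq_card_filter_range]
      congr 1
      refine Finset.filter_congr fun j hj => ?_
      rw [Finset.mem_range] at hj
      rw [Doubled, Doubled, trunc, trunc, if_pos (by omega), if_pos (by omega)]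
    simp only [this]

/-- Multiplying independent uniform signs by fixed signs preserves their law. -/
lemma measurePreserving_mul_coin {b : ℕ → ℝ} (hb : IsSigns b) :
    MeasurePreserving (fun (s : ℕ → ℝ) n => s n * b n) coinMeasure coinMeasure :=
  measurePreserving_mul_predictable (h := fun n _ => b n) (fun _ => measurable_const)
    (fun n _ => hb n) fun _ _ => rfl

/-- For fixed `s` the flip sign is almost surely `y k` times the fixed sign `bridgeIncr s k / 2`. -/
lemma map_flipSign {s : ℕ → ℝ} (hs : Regular s) :
    coinMeasure.map (flipSign s) = coinMeasure := by
  have hb : IsSigns fun k => bridgeIncr s k / 2 := fun k => by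
    rcases eq_or_eq_neg_of_abs_eq (hs.abs_bridge k) with h | h <;>
      simp [bridgeIncr, h]
  refine Eq.trans ?_ (measurePreserving_mul_coin hb).map_eq
  refine Measure.map_congr ?_
  filter_upwards [ae_isSigns] with y hy
  funext k
  have hk : bridgeIncr s k = 2 * (bridgeIncr s k / 2) := by ring
  rw [flipSign, hk]
  rcases hb k with h | h <;> rcases hy k with h' | h' <;> simp only [h, h'] <;> norm_num

/-- Twisting independent signs by independent signs gives independent signs. -/
theorem measurePreserving_twist :
    MeasurePreserving (fun p : (ℕ → ℝ) × (ℕ → ℝ) => twist p.1 p.2) (coinMeasure.prod coinMeasure)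
      coinMeasure := by
  -- A flip depends on how its bridge ends, so it is not predictable from `s` alone. But given `s`,
  -- the flips have the law of fair signs, so they may replace `y` as a sequence independent of `s`.
  have h1 : MeasurePreserving (fun p : (ℕ → ℝ) × (ℕ → ℝ) => (p.1, flipSign p.1 p.2))
      (coinMeasure.prod coinMeasure) (coinMeasure.prod coinMeasure) := by
    refine (MeasurePreserving.id coinMeasure).skew_product (g := flipSign) ?_ ?_
    · exact measurable_pi_lambda _ measurable_flipSign
    · filter_upwards [ae_regular] with s hs using map_flipSign hs
  -- With the flips `σ` held fixed, the factor of step `n` depends only on earlier steps of `s`, and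
  -- the predictable invariance applies.
  have h2 : MeasurePreserving (fun p : (ℕ → ℝ) × (ℕ → ℝ) => (p.1, fun n =>
        p.2 n * if p.1 (doubledCount p.2 (n / 2)) = 1 then (1 : ℝ) else -1))
      (coinMeasure.prod coinMeasure) (coinMeasure.prod coinMeasure) := by
    refine (MeasurePreserving.id coinMeasure).skew_product (g := fun σ s n =>
        s n * if σ (doubledCount s (n / 2)) = 1 then (1 : ℝ) else -1) ?_ ?_
    · refine measurable_pi_lambda _ fun n => Measurable.mul (by fun_prop) ?_
      refine Measurable.ite ?_ measurable_const measurable_const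
      have : Measurable fun p : (ℕ → ℝ) × (ℕ → ℝ) => p.1 (doubledCount p.2 (n / 2)) :=
        measurable_comp_nat (f := fun k (p : (ℕ → ℝ) × (ℕ → ℝ)) => p.1 k) (fun k => by fun_prop)
          ((measurable_doubledCount (n / 2)).comp measurable_snd)
      exact this (measurableSet_singleton 1)
    · exact Filter.Eventually.of_forall fun σ => (measurePreserving_mul_bridge σ).map_eq
  have h3 := measurePreserving_snd.comp (h2.comp (Measure.measurePreserving_swap.comp h1))
  refine ⟨measurable_twist, ?_⟩
  refine Eq.trans ?_ h3.map_eq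
  refine Measure.map_congr ?_
  have hreg : ∀ᵐ p : (ℕ → ℝ) × (ℕ → ℝ) ∂coinMeasure.prod coinMeasure, Regular p.1 :=
    Measure.quasiMeasurePreserving_fst.ae ae_regular
  filter_upwards [hreg] with p hp
  funext n
  simp only [Function.comp_apply, Prod.swap, twist_eq, hp.bridge_eq, flipSign]
  split_ifs <;> simp_all

end TwistShrink

/-! ### The rows of the random matrix: laws and independence. -/

namespace TwistShrink

lemma eq_signMeasure {μ : Measure ℝ} [IsProbabilityMeasure μ] (h1 : μ {1} = 1 / 2)
    (h2 : μ {-1} = 1 / 2) : μ = signMeasure := by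
  have hd : Disjoint ({1} : Set ℝ) {-1} := by
    rw [Set.disjoint_singleton]
    norm_num
  have hU : μ ({1} ∪ {-1}) = 1 := by
    rw [measure_union hd (measurableSet_singleton _), h1, h2, one_div, ENNReal.inv_two_add_inv_two]
  have hr : μ.restrict ({1} ∪ {-1}) = μ := by
    refine Measure.restrict_eq_self_of_ae_mem ?_
    rw [← prob_compl_eq_zero_iff (by measurability)] at hU
    exact hU
  rw [← hr, Measure.restrict_union hd (measurableSet_singleton _), Measure.restrict_singleton,
    Measure.restrict_singleton, h1, h2, signMeasure]

section Rows

variable {Ω : Type*} {X : ℕ → ℕ → Ω → ℝ}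

/-- The steps of the `m`-th original walk, numbered from `0`. -/
def row (X : ℕ → ℕ → Ω → ℝ) (m : ℕ) (ω : Ω) (k : ℕ) : ℝ := X m (k + 1) ω

/-- The steps of the `m`-th twisted walk, numbered from `0`. -/
noncomputable def twistedRow (X : ℕ → ℕ → Ω → ℝ) (m : ℕ) (ω : Ω) (k : ℕ) : ℝ :=
  twistedStep (fun i k => X i k ω) m (k + 1)

lemma twistedRow_succ (X : ℕ → ℕ → Ω → ℝ) (m : ℕ) (ω : Ω) :
    twistedRow X (m + 1) ω = twist (row X (m + 1) ω) (twistedRow X m ω) := by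
  funext k
  exact twistedStep_succ_succ _ m k

lemma walk_twistedStep (X : ℕ → ℕ → Ω → ℝ) (m : ℕ) (ω : Ω) :
    walk (twistedStep (fun i k => X i k ω) m) = walk (pad (twistedRow X m ω)) := by
  refine walk_congr fun n hn => ?_
  rw [pad, twistedRow, Nat.sub_add_cancel hn]

lemma measurable_row_of {m₀ : MeasurableSpace Ω} {i : ℕ} (h : ∀ k, Measurable (X i (k + 1))) :
    Measurable (row X i) :=
  measurable_pi_lambda _ h

/-- The `m`-th twisted row uses only rows up to `m`, hence is independent of row `m + 1`. -/
lemma measurable_twistedRow_iSup (m : ℕ) :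
    Measurable[⨆ p ∈ {p : ℕ × ℕ | p.1 ≤ m},
      MeasurableSpace.comap (X p.1 (p.2 + 1)) inferInstance] (twistedRow X m) := by
  have hrow : ∀ i n : ℕ, i ≤ n → Measurable[⨆ p ∈ {p : ℕ × ℕ | p.1 ≤ n},
      MeasurableSpace.comap (X p.1 (p.2 + 1)) inferInstance] (row X i) := by
    intro i n hin
    refine measurable_row_of fun k => ?_
    exact (comap_measurable (X i (k + 1))).mono
      (le_iSup₂_of_le (i, k) hin le_rfl) le_rfl
  induction m with
  | zero => exact hrow 0 0 le_rfl
  | succ m ih =>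
    have h1 : twistedRow X (m + 1) = (fun p : (ℕ → ℝ) × (ℕ → ℝ) => twist p.1 p.2) ∘
        fun ω => (row X (m + 1) ω, twistedRow X m ω) := by
      funext ω
      exact twistedRow_succ X m ω
    rw [h1]
    refine measurable_twist.comp ((hrow (m + 1) (m + 1) le_rfl).prodMk (ih.mono ?_ le_rfl))
    exact biSup_mono fun p (hp : p.1 ≤ m) => hp.trans (Nat.le_succ m)

variable [MeasurableSpace Ω] {P : Measure Ω}

namespace IsSignMatrix

lemma hasLaw [IsProbabilityMeasure P] (hX : IsSignMatrix P X) (m k : ℕ) : HasLaw (X m (k + 1)) signMeasure P where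
  aemeasurable := (hX.measurable m (k + 1) (by omega)).aemeasurable
  map_eq := by
    have hm := hX.measurable m (k + 1) (by omega)
    have := Measure.isProbabilityMeasure_map (μ := P) hm.aemeasurable
    refine eq_signMeasure ?_ ?_
    · rw [Measure.map_apply hm (measurableSet_singleton _)]
      exact hX.prob_one m (k + 1) (by omega)
    · rw [Measure.map_apply hm (measurableSet_singleton _)]
      exact hX.prob_neg_one m (k + 1) (by omega)

lemma measurable_row (hX : IsSignMatrix P X) (m : ℕ) : Measurable (row X m) :=
  measurable_row_of fun k => hX.measurable m (k + 1) (by omega)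

lemma measurePreserving_row [IsProbabilityMeasure P] (hX : IsSignMatrix P X) (m : ℕ) :
    MeasurePreserving (row X m) P coinMeasure := by
  have hi : iIndepFun (fun k => X m (k + 1)) P :=
    hX.indep.precomp (g := fun k : ℕ => (m, k)) fun a b h => by simpa using h
  exact ⟨hX.measurable_row m, (hi.hasLaw_infinitePi (fun k => hX.hasLaw m k)
    (hX.measurable_row m).aemeasurable).map_eq⟩

lemma measurable_twistedRow (hX : IsSignMatrix P X) (m : ℕ) : Measurable (twistedRow X m) :=
  (measurable_twistedRow_iSup m).mono (iSup₂_le fun p _ =>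
    (hX.measurable p.1 (p.2 + 1) (by omega)).comap_le) le_rfl

lemma indepFun_row_twistedRow [IsProbabilityMeasure P] (hX : IsSignMatrix P X) (m : ℕ) :
    IndepFun (row X (m + 1)) (twistedRow X m) P := by
  have hle : ∀ p : ℕ × ℕ, MeasurableSpace.comap (X p.1 (p.2 + 1)) inferInstance ≤
      ‹MeasurableSpace Ω› := fun p => (hX.measurable p.1 (p.2 + 1) (by omega)).comap_le
  have hdis : Disjoint {p : ℕ × ℕ | p.1 = m + 1} {p : ℕ × ℕ | p.1 ≤ m} := by
    rw [Set.disjoint_left]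
    intro p hp hp'
    simp only [Set.mem_ofPred_eq] at hp hp'
    omega
  have h := indep_iSup_of_disjoint hle hX.indep.iIndep hdis
  rw [IndepFun_iff_Indep]
  refine indep_of_indep_of_le_left (indep_of_indep_of_le_right h ?_) ?_
  · exact (measurable_twistedRow_iSup m).comap_le
  · refine Measurable.comap_le ?_
    refine measurable_row_of fun k => ?_
    exact (comap_measurable (X (m + 1) (k + 1))).mono
      (le_iSup₂_of_le (m + 1, k) rfl le_rfl) le_rfl

lemma measurePreserving_row_twistedRow [IsProbabilityMeasure P] (hX : IsSignMatrix P X) {m : ℕ}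
    (h : MeasurePreserving (twistedRow X m) P coinMeasure) :
    MeasurePreserving (fun ω => (row X (m + 1) ω, twistedRow X m ω)) P
      (coinMeasure.prod coinMeasure) := by
  refine ⟨(hX.measurable_row (m + 1)).prodMk (hX.measurable_twistedRow m), ?_⟩
  rw [(hX.indepFun_row_twistedRow m).map_prod_eq_prod_map_map
    (hX.measurable_row (m + 1)).aemeasurable (hX.measurable_twistedRow m).aemeasurable,
    (hX.measurePreserving_row (m + 1)).map_eq, h.map_eq]

/-- The steps of each twisted walk are independent signs. -/
theorem measurePreserving_twistedRow [IsProbabilityMeasure P] (hX : IsSignMatrix P X) (m : ℕ) :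
    MeasurePreserving (twistedRow X m) P coinMeasure := by
  induction m with
  | zero => exact hX.measurePreserving_row 0
  | succ m ih =>
    have h := measurePreserving_twist.comp (hX.measurePreserving_row_twistedRow ih)
    convert h using 1
    funext ω
    exact twistedRow_succ X m ω

lemma ae_regular_row [IsProbabilityMeasure P] (hX : IsSignMatrix P X) : ∀ᵐ ω ∂P, ∀ m, Regular (row X m ω) :=
  ae_all_iff.2 fun m => (hX.measurePreserving_row m).quasiMeasurePreserving.ae ae_regular

lemma ae_isSigns_twistedRow [IsProbabilityMeasure P] (hX : IsSignMatrix P X) :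
    ∀ᵐ ω ∂P, ∀ m, IsSigns (twistedRow X m ω) :=
  ae_all_iff.2 fun m => (hX.measurePreserving_twistedRow m).quasiMeasurePreserving.ae ae_isSigns

end IsSignMatrix

end Rows

end TwistShrink

namespace TwistShrink

/-! ### Linear interpolation -/

lemma abs_sub_le_of_step {s : ℕ → ℝ} (hs : ∀ n, |s (n + 1) - s n| ≤ 1) {a b : ℕ} (hab : a ≤ b) :
    |s b - s a| ≤ b - a := by
  induction b, hab using Nat.le_induction with
  | base => simp
  | succ b hab ih =>
    have h1 := abs_le.1 ih
    have h2 := abs_le.1 (hs b)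
    rw [abs_le]
    push_cast
    constructor <;> linarith [h1.1, h1.2, h2.1, h2.2]

@[simp] lemma interp_natCast (s : ℕ → ℝ) (n : ℕ) : interp s n = s n := by simp [interp]

lemma abs_interp_sub_le_of_floor {s : ℕ → ℝ} (hs : ∀ n, |s (n + 1) - s n| ≤ 1) {u : ℝ}
    (hu : 0 ≤ u) : |interp s u - s ⌊u⌋₊| ≤ u - ⌊u⌋₊ := by
  have h0 : 0 ≤ u - ⌊u⌋₊ := sub_nonneg.2 (Nat.floor_le hu)
  rw [interp, add_sub_cancel_left, abs_mul, abs_of_nonneg h0]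
  exact mul_le_of_le_one_right h0 (hs _)

lemma abs_interp_sub_le_of_floor_succ {s : ℕ → ℝ} (hs : ∀ n, |s (n + 1) - s n| ≤ 1) (u : ℝ) :
    |s (⌊u⌋₊ + 1) - interp s u| ≤ ⌊u⌋₊ + 1 - u := by
  have h0 : 0 ≤ (⌊u⌋₊ : ℝ) + 1 - u := by linarith [Nat.lt_floor_add_one u]
  have : s (⌊u⌋₊ + 1) - interp s u = (⌊u⌋₊ + 1 - u) * (s (⌊u⌋₊ + 1) - s ⌊u⌋₊) := by
    rw [interp]
    ring
  rw [this, abs_mul, abs_of_nonneg h0]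
  exact mul_le_of_le_one_right h0 (hs _)

lemma abs_interp_sub_interp_le {s : ℕ → ℝ} (hs : ∀ n, |s (n + 1) - s n| ≤ 1) {u v : ℝ}
    (hu : 0 ≤ u) (huv : u ≤ v) : |interp s v - interp s u| ≤ v - u := by
  rcases (Nat.floor_mono huv).eq_or_lt with h | h
  · have : interp s v - interp s u = (v - u) * (s (⌊u⌋₊ + 1) - s ⌊u⌋₊) := by
      rw [interp, interp, ← h]
      ring
    rw [this, abs_mul, abs_of_nonneg (sub_nonneg.2 huv)]
    exact mul_le_of_le_one_right (sub_nonneg.2 huv) (hs _)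
  -- Here `u < ⌊u⌋ + 1 ≤ ⌊v⌋ ≤ v`, and the bounds on the three pieces add up.
  · have h1 := abs_le.1 (abs_interp_sub_le_of_floor hs (hu.trans huv))
    have h2 := abs_le.1 (abs_interp_sub_le_of_floor_succ hs u)
    have h3 := abs_le.1 (abs_sub_le_of_step hs (Nat.succ_le_of_lt h))
    push_cast at h3
    rw [abs_le]
    constructor <;> linarith [h1.1, h1.2, h2.1, h2.2, h3.1, h3.2]

lemma continuousOn_interp {s : ℕ → ℝ} (hs : ∀ n, |s (n + 1) - s n| ≤ 1) :
    ContinuousOn (interp s) (Set.Ici 0) := by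
  refine LipschitzOnWith.continuousOn (K := 1) (LipschitzOnWith.of_dist_le_mul fun u hu v hv => ?_)
  rw [NNReal.coe_one, one_mul, Real.dist_eq, Real.dist_eq]
  rcases le_total u v with h | h
  · rw [abs_sub_comm, abs_sub_comm u v, abs_of_nonneg (sub_nonneg.2 h)]
    exact abs_interp_sub_interp_le hs hu h
  · rw [abs_of_nonneg (sub_nonneg.2 h)]
    exact abs_interp_sub_interp_le hs hv h

lemma IsSigns.abs_walk_step {s : ℕ → ℝ} (hs : IsSigns s) (n : ℕ) :
    |walk (pad s) (n + 1) - walk (pad s) n| ≤ 1 := by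
  rw [walk_succ, add_sub_cancel_left, pad_succ]
  rcases hs n with h | h <;> rw [h] <;> norm_num

/-! ### Comparison of consecutive twisted walks -/

/-- At `k = ⌊u⌋` the twisted walk at `T(k)` is twice the coarse walk at `k`, and `T(k)` is within
`2a` of `4k`, which costs `x`. Replacing `4u` by `4k` costs at most 4 and `u` by `k`, doubled, at
most 2; hence the 6. -/
lemma abs_interp_twist_sub_le {s y : ℕ → ℝ} (hs : Regular s) (hy : IsSigns y) {a x u : ℝ} {J : ℕ}
    (hR : ∀ n ≤ J, |∑ j ∈ Finset.range n, pairProd s j| ≤ a) (hu : 0 ≤ u) (hJ : 2 * u + a ≤ J)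
    (hD : ∀ q : ℕ, |(q : ℝ) - 4 * ⌊u⌋₊| ≤ 2 * a →
      |walk (pad (twist s y)) q - walk (pad (twist s y)) (4 * ⌊u⌋₊)| ≤ x) :
    |interp (walk (pad (twist s y))) (4 * u) - 2 * interp (walk (pad y)) u| ≤ x + 6 := by
  have hfl := Nat.floor_le hu
  have hT := hD _ (hs.abs_stopTime_sub_le hR (k := ⌊u⌋₊) (by linarith))
  rw [hs.walk_twist hy] at hT
  have hz : IsSigns (twist s y) := hs.signs.twist
  have h1 := abs_interp_sub_interp_le hz.abs_walk_step (u := ((4 * ⌊u⌋₊ : ℕ) : ℝ)) (v := 4 * u)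
    (Nat.cast_nonneg _) (by push_cast; linarith)
  have h2 := abs_interp_sub_le_of_floor hy.abs_walk_step hu
  rw [interp_natCast] at h1
  push_cast at h1
  have hlt := Nat.lt_floor_add_one u
  rw [abs_le] at *
  constructor <;> linarith [h1.1, h1.2, h2.1, h2.2, hT.1, hT.2]

/-! ### Probability bounds -/

lemma coin_exists_pairProd_le {a : ℝ} (ha : 0 ≤ a) (J : ℕ) :
    coinMeasure.real {s | ∃ n ≤ J, a < |∑ j ∈ Finset.range n, pairProd s j|} ≤
      2 * J * Real.exp (-a ^ 2 / (2 * J)) := by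
  calc coinMeasure.real {s | ∃ n ≤ J, a < |∑ j ∈ Finset.range n, pairProd s j|}
      -- The empty sum never exceeds `a ≥ 0`, so `n = 0` is dropped; this leaves `J` terms and
      -- positive denominators.
      ≤ coinMeasure.real (⋃ n ∈ Finset.Icc 1 J, {s | a ≤ |∑ j ∈ Finset.range n, pairProd s j|}) := by
        refine measureReal_mono ?_ (measure_ne_top _ _)
        rintro s ⟨n, hn, h⟩
        simp only [Set.mem_iUnion, Finset.mem_Icc]
        refine ⟨n, ⟨?_, hn⟩, h.le⟩
        rcases Nat.eq_zero_or_pos n with rfl | h0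
        · simp at h
          linarith
        · exact h0
    _ ≤ ∑ n ∈ Finset.Icc 1 J, coinMeasure.real {s | a ≤ |∑ j ∈ Finset.range n, pairProd s j|} :=
        measureReal_biUnion_finset_le _ _
    _ ≤ ∑ n ∈ Finset.Icc 1 J, 2 * Real.exp (-a ^ 2 / (2 * J)) := by
        refine Finset.sum_le_sum fun n hn => ?_
        rw [Finset.mem_Icc] at hn
        refine (coin_abs_sum_pairProd_ge_le _ ha).trans ?_
        rw [Finset.card_range, neg_div, neg_div]
        have h1 : (1 : ℝ) ≤ n := by exact_mod_cast hn.1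
        have h2 : (n : ℝ) ≤ J := by exact_mod_cast hn.2
        gcongr
    _ = _ := by
        rw [Finset.sum_const, Nat.card_Icc, nsmul_eq_mul]
        simp
        ring

lemma coin_abs_walk_sub_le {x d : ℝ} (hx : 0 ≤ x) {p q : ℕ} (hpq : |(q : ℝ) - p| ≤ d) :
    coinMeasure.real {s | x < |walk (pad s) q - walk (pad s) p|} ≤
      2 * Real.exp (-x ^ 2 / (2 * d)) := by
  wlog hle : p ≤ q generalizing p q
  · have := this (p := q) (q := p) (by rwa [abs_sub_comm]) (by omega)
    simpa only [abs_sub_comm] using this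
  rcases hle.eq_or_lt with rfl | hlt
  · have : {s : ℕ → ℝ | x < |walk (pad s) p - walk (pad s) p|} = ∅ := by
      ext s
      simpa using hx
    rw [this, measureReal_empty]
    positivity
  · have hcast : (p : ℝ) < q := by exact_mod_cast hlt
    rw [abs_of_nonneg (by linarith)] at hpq
    have h1 := coin_abs_sum_ge_le (Finset.Ico p q) hx
    rw [Nat.card_Ico, Nat.cast_sub hle] at h1
    refine (measureReal_mono fun s hs => ?_).trans (h1.trans ?_)
    · simp only [Set.mem_ofPred_eq, walk_pad] at hs ⊢
      rw [Finset.sum_Ico_eq_sub _ hle]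
      exact hs.le
    · rw [neg_div, neg_div]
      have : (0 : ℝ) < q - p := by linarith
      gcongr

lemma coin_exists_walk_sub_le {x d : ℝ} (hx : 0 ≤ x) (hd : 0 ≤ d) (M : ℕ) :
    coinMeasure.real {s | ∃ k ≤ M, ∃ q : ℕ, |(q : ℝ) - 4 * k| ≤ d ∧
        x < |walk (pad s) q - walk (pad s) (4 * k)|} ≤
      (M + 1) * (2 * d + 1) * (2 * Real.exp (-x ^ 2 / (2 * d))) := by
  set D : ℕ := ⌊d⌋₊ with hDdef
  have hDd : (D : ℝ) ≤ d := Nat.floor_le hd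
  calc _ ≤ coinMeasure.real (⋃ k ∈ Finset.range (M + 1), ⋃ q ∈ Finset.Icc (4 * k - D) (4 * k + D),
        {s | x < |walk (pad s) q - walk (pad s) (4 * k)|}) := by
        refine measureReal_mono ?_ (measure_ne_top _ _)
        rintro s ⟨k, hk, q, hq, h⟩
        simp only [Set.mem_iUnion, Finset.mem_range, Finset.mem_Icc]
        refine ⟨k, by omega, q, ?_, h⟩
        rw [abs_le] at hq
        have h1 : q - 4 * k ≤ D := Nat.le_floor (by
          rcases le_total q (4 * k) with h | h
          · rw [Nat.sub_eq_zero_of_le h]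
            simpa using hd
          · rw [Nat.cast_sub h]
            push_cast
            linarith)
        have h2 : 4 * k - q ≤ D := Nat.le_floor (by
          rcases le_total (4 * k) q with h | h
          · rw [Nat.sub_eq_zero_of_le h]
            simpa using hd
          · rw [Nat.cast_sub h]
            push_cast
            linarith)
        omega
    _ ≤ ∑ k ∈ Finset.range (M + 1), ∑ q ∈ Finset.Icc (4 * k - D) (4 * k + D),
          coinMeasure.real {s | x < |walk (pad s) q - walk (pad s) (4 * k)|} :=
        (measureReal_biUnion_finset_le _ _).trans
          (Finset.sum_le_sum fun k _ => measureReal_biUnion_finset_le _ _)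
    _ ≤ ∑ k ∈ Finset.range (M + 1), ∑ q ∈ Finset.Icc (4 * k - D) (4 * k + D),
          2 * Real.exp (-x ^ 2 / (2 * d)) := by
        refine Finset.sum_le_sum fun k _ => Finset.sum_le_sum fun q hq => ?_
        rw [Finset.mem_Icc] at hq
        refine coin_abs_walk_sub_le hx (le_trans ?_ hDd)
        have h1 : ((4 * k : ℕ) : ℝ) ≤ q + D := by
          have : 4 * k ≤ q + D := by omega
          exact_mod_cast this
        have h2 : (q : ℝ) ≤ (4 * k : ℕ) + D := by exact_mod_cast hq.2
        rw [abs_le]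
        constructor <;> linarith
    _ ≤ ∑ k ∈ Finset.range (M + 1), (2 * d + 1) * (2 * Real.exp (-x ^ 2 / (2 * d))) := by
        refine Finset.sum_le_sum fun k _ => ?_
        rw [Finset.sum_const, nsmul_eq_mul]
        refine mul_le_mul_of_nonneg_right ?_ (by positivity)
        have : (Finset.Icc (4 * k - D) (4 * k + D)).card ≤ 2 * D + 1 := by
          rw [Nat.card_Icc]
          omega
        have h : ((Finset.Icc (4 * k - D) (4 * k + D)).card : ℝ) ≤ 2 * D + 1 := by
          exact_mod_cast this
        linarith
    _ = _ := by
        rw [Finset.sum_const, Finset.card_range, nsmul_eq_mul]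
        push_cast
        ring

/-! ### Choice of the deviation levels and their tail estimates. -/

/-- `N` is large enough, depending on `C`, for the tail bounds below. -/
structure LargeFor (C N : ℝ) : Prop where
  le : (10 : ℝ) ^ 6 ≤ N
  log_le : 2500 * C * Real.log N ≤ N ^ (1 / 5 : ℝ)

lemma eventually_largeFor (C : ℝ) : ∀ᶠ N in Filter.atTop, LargeFor C N := by
  have h := (isLittleO_log_rpow_atTop (show (0 : ℝ) < 1 / 5 by norm_num)).bound
    (show (0 : ℝ) < 1 / (2500 * (|C| + 1)) by positivity)
  filter_upwards [h, Filter.eventually_ge_atTop ((10 : ℝ) ^ 6)] with N hN hN'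
  refine ⟨hN', ?_⟩
  have h0 : 0 ≤ Real.log N := Real.log_nonneg (by linarith)
  have hN0 : (0 : ℝ) ≤ N := le_trans (by norm_num) hN'
  rw [Real.norm_of_nonneg h0, Real.norm_of_nonneg (by positivity), one_div, ← div_eq_inv_mul,
    le_div_iff₀ (by positivity)] at hN
  nlinarith [le_abs_self C]

/-- The bound for the fluctuation of the stopping times. -/
noncomputable def timeDev (C N : ℝ) : ℝ := 5 / 2 * √(C * Real.log N) * √N

/-- The bound for the fluctuation of the walk between the stopping times and their means. -/
noncomputable def spaceDev (C N : ℝ) : ℝ := 4 * (C * Real.log N) ^ (3 / 4 : ℝ) * N ^ (1 / 4 : ℝ)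

lemma spaceDev_nonneg {C N : ℝ} (hC : 0 ≤ C) (hN : 1 ≤ N) : 0 ≤ spaceDev C N := by
  have := Real.log_nonneg hN
  unfold spaceDev
  positivity

lemma rpow_three_quarters_sq {y : ℝ} (hy : 0 ≤ y) : (y ^ (3 / 4 : ℝ)) ^ 2 = y * √y := by
  rw [← Real.rpow_natCast, ← Real.rpow_mul hy, Real.sqrt_eq_rpow,
    show (3 / 4 : ℝ) * (2 : ℕ) = 1 + 1 / 2 by norm_num, Real.rpow_add' hy (by norm_num),
    Real.rpow_one]

lemma rpow_quarter_sq {y : ℝ} (hy : 0 ≤ y) : (y ^ (1 / 4 : ℝ)) ^ 2 = √y := by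
  rw [← Real.rpow_natCast, ← Real.rpow_mul hy, Real.sqrt_eq_rpow]
  norm_num

namespace LargeFor

variable {C N : ℝ}

lemma pos (h : LargeFor C N) : 0 < N := lt_of_lt_of_le (by norm_num) h.le

lemma one_le (h : LargeFor C N) : 1 ≤ N := le_trans (by norm_num) h.le

lemma one_le_log (h : LargeFor C N) : 1 ≤ Real.log N := by
  rw [Real.le_log_iff_exp_le h.pos]
  linarith [h.le, Real.exp_one_lt_d9]

lemma timeDev_le (h : LargeFor C N) : timeDev C N ≤ N ^ (3 / 5 : ℝ) / 20 := by
  -- The factor 2500 in `log_le` is `50²`.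
  have h1 : √(C * Real.log N) ≤ N ^ (1 / 10 : ℝ) / 50 := by
    refine Real.sqrt_le_iff.2 ⟨by have := h.pos; positivity, ?_⟩
    rw [div_pow, ← Real.rpow_natCast, ← Real.rpow_mul h.pos.le]
    norm_num
    have := h.log_le
    norm_num at this
    linarith
  have h2 : N ^ (3 / 5 : ℝ) = N ^ (1 / 10 : ℝ) * √N := by
    rw [Real.sqrt_eq_rpow, ← Real.rpow_add h.pos]
    norm_num
  rw [timeDev, h2]
  have := mul_le_mul_of_nonneg_right h1 (Real.sqrt_nonneg N)
  linarith

lemma one_le_timeDev (hC : 1 < C) (h : LargeFor C N) : 1 ≤ timeDev C N := by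
  have h1 : 1 ≤ √(C * Real.log N) := Real.one_le_sqrt.2 (by nlinarith [h.one_le_log])
  have h2 : 1 ≤ √N := Real.one_le_sqrt.2 h.one_le
  rw [timeDev]
  nlinarith

lemma timeDev_le_div (h : LargeFor C N) : timeDev C N ≤ N / 20 := by
  refine h.timeDev_le.trans ?_
  have := Real.rpow_le_rpow_of_exponent_le h.one_le (show (3 / 5 : ℝ) ≤ 1 by norm_num)
  rw [Real.rpow_one] at this
  linarith

lemma exp_neg_mul_log (h : LargeFor C N) (c : ℝ) :
    Real.exp (-(c * Real.log N)) = N ^ (-c) := by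
  rw [Real.rpow_def_of_pos h.pos]
  ring_nf

/-- Since `2J ≤ 5N`, the factor 5/2 in `timeDev` yields the exponent `-5C/4`. The surplus `N^(C/4)`
absorbs the 5 of the prefactor `5N`, because `N ≥ 10^6 ≥ 5^4`. -/
lemma time_tail_le (hC : 1 < C) (h : LargeFor C N) {J : ℕ} (hJ0 : 0 < J)
    (hJ : (J : ℝ) ≤ 5 / 2 * N) :
    2 * J * Real.exp (-timeDev C N ^ 2 / (2 * J)) ≤ N ^ (1 - C) := by
  have hN := h.pos
  have hL := h.one_le_log
  have hJ0' : (0 : ℝ) < J := by exact_mod_cast hJ0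
  have hsq : timeDev C N ^ 2 = 25 / 4 * (C * Real.log N) * N := by
    rw [timeDev, mul_pow, mul_pow, Real.sq_sqrt (by positivity), Real.sq_sqrt hN.le]
    ring
  have hexp : Real.exp (-timeDev C N ^ 2 / (2 * J)) ≤ N ^ (-(5 / 4 * C)) := by
    rw [← h.exp_neg_mul_log, Real.exp_le_exp, neg_div, neg_le_neg_iff, le_div_iff₀ (by positivity),
      hsq]
    have : 0 ≤ C * Real.log N := by positivity
    nlinarith
  have h5 : 5 ≤ N ^ (C / 4) := by
    calc (5 : ℝ) = (5 ^ 4 : ℝ) ^ (1 / 4 : ℝ) := by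
          rw [← Real.rpow_natCast, ← Real.rpow_mul (by norm_num)]
          norm_num
      _ ≤ N ^ (1 / 4 : ℝ) := Real.rpow_le_rpow (by norm_num) (by linarith [h.le]) (by norm_num)
      _ ≤ N ^ (C / 4) := Real.rpow_le_rpow_of_exponent_le h.one_le (by linarith)
  calc 2 * J * Real.exp (-timeDev C N ^ 2 / (2 * J)) ≤ 5 * N * N ^ (-(5 / 4 * C)) := by
        refine mul_le_mul (by linarith) hexp (by positivity) (by positivity)
    _ ≤ N ^ (C / 4) * N * N ^ (-(5 / 4 * C)) := by gcongr
    _ = N ^ (1 - C) := by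
        nth_rewrite 2 [← Real.rpow_one N]
        rw [← Real.rpow_add hN, ← Real.rpow_add hN]
        ring_nf

/-- The levels are matched so that the exponent is exactly `-(8/5) C log N`, against a prefactor of
at most `N^(8/5)`; the product is `N^(8/5 (1-C))`. -/
lemma space_tail_le (hC : 1 < C) (h : LargeFor C N) {M : ℕ} (hM : (M : ℝ) ≤ N) :
    (M + 1) * (2 * (2 * timeDev C N) + 1) *
      (2 * Real.exp (-spaceDev C N ^ 2 / (2 * (2 * timeDev C N)))) ≤ N ^ (1 - C) := by
  have hN := h.pos
  have hL := h.one_le_log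
  have ha := h.one_le_timeDev hC
  have hCL : 0 < C * Real.log N := by positivity
  have hquot : spaceDev C N ^ 2 / (2 * (2 * timeDev C N)) = 8 / 5 * C * Real.log N := by
    rw [spaceDev, mul_pow, mul_pow, rpow_three_quarters_sq hCL.le, rpow_quarter_sq hN.le, timeDev]
    have h1 : √(C * Real.log N) ≠ 0 := (Real.sqrt_pos.2 hCL).ne'
    have h2 : √N ≠ 0 := (Real.sqrt_pos.2 hN).ne'
    field_simp
    norm_num
  rw [neg_div, hquot, h.exp_neg_mul_log]
  calc (M + 1) * (2 * (2 * timeDev C N) + 1) * (2 * N ^ (-(8 / 5 * C)))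
      ≤ (2 * N) * (N ^ (3 / 5 : ℝ) / 4) * (2 * N ^ (-(8 / 5 * C))) := by
        gcongr
        · linarith [h.one_le]
        · linarith [h.timeDev_le]
    _ = N ^ (8 / 5 * (1 - C)) := by
        rw [show 8 / 5 * (1 - C) = 1 + 3 / 5 + -(8 / 5 * C) by ring, Real.rpow_add hN,
          Real.rpow_add hN, Real.rpow_one]
        ring
    _ ≤ N ^ (1 - C) := Real.rpow_le_rpow_of_exponent_le h.one_le (by linarith)

end LargeFor

section

variable {Ω : Type*} [MeasurableSpace Ω] {P : Measure Ω} {X : ℕ → ℕ → Ω → ℝ}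

/-- The inequality needs no measurability of `S`, so the bad events can be used as they are. -/
lemma measureReal_preimage_le {f : Ω → ℕ → ℝ} (hf : MeasurePreserving f P coinMeasure)
    (S : Set (ℕ → ℝ)) : P.real (f ⁻¹' S) ≤ coinMeasure.real S := by
  have h := Measure.le_map_apply (μ := P) hf.measurable.aemeasurable S
  rw [hf.map_eq] at h
  exact ENNReal.toReal_mono (measure_ne_top _ _) h

/-- Consecutive twisted walks are uniformly close, up to a small probability. -/
theorem IsSignMatrix.tail_step [IsProbabilityMeasure P] (hX : IsSignMatrix P X) {C N : ℝ}
    (hC : 1 < C) (h : LargeFor C N) (n : ℕ) :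
    P.real {ω | ¬ ∀ u : ℝ, 0 ≤ u → u ≤ N →
      |interp (walk (pad (twistedRow X (n + 1) ω))) (4 * u) -
        2 * interp (walk (pad (twistedRow X n ω))) u| ≤ spaceDev C N + 6} ≤ 2 * N ^ (1 - C) := by
  set a := timeDev C N with ha
  set x := spaceDev C N with hx
  -- Enough pairs for the first `⌊N⌋` bridges to end, and still at most `5/2 N` because `a ≤ N/20`.
  set J : ℕ := ⌈2 * N + a⌉₊ with hJ
  have ha1 : 1 ≤ a := h.one_le_timeDev hC
  have hx0 : 0 ≤ x := spaceDev_nonneg (by linarith) h.one_le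
  have hJle : 2 * N + a ≤ J := Nat.le_ceil _
  have hJlt : (J : ℝ) < 2 * N + a + 1 := Nat.ceil_lt_add_one (by linarith [h.pos])
  have hJ0 : 0 < J := by
    have : (0 : ℝ) < J := by linarith [h.pos]
    exact_mod_cast this
  set E₁ : Set (ℕ → ℝ) := {s | ∃ n ≤ J, a < |∑ j ∈ Finset.range n, pairProd s j|} with hE₁
  set E₂ : Set (ℕ → ℝ) := {s | ∃ k ≤ ⌊N⌋₊, ∃ q : ℕ, |(q : ℝ) - 4 * k| ≤ 2 * a ∧
    x < |walk (pad s) q - walk (pad s) (4 * k)|} with hE₂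
  have h1 : P.real (row X (n + 1) ⁻¹' E₁) ≤ N ^ (1 - C) :=
    (measureReal_preimage_le (hX.measurePreserving_row (n + 1)) _).trans
      ((coin_exists_pairProd_le (by linarith) J).trans
        (h.time_tail_le hC hJ0 (by linarith [h.timeDev_le_div, h.le])))
  have h2 : P.real (twistedRow X (n + 1) ⁻¹' E₂) ≤ N ^ (1 - C) :=
    (measureReal_preimage_le (hX.measurePreserving_twistedRow (n + 1)) _).trans
      ((coin_exists_walk_sub_le hx0 (by linarith) _).trans
        (h.space_tail_le hC (Nat.floor_le h.pos.le)))
  have hae : ∀ᵐ ω ∂P, ω ∈ {ω | ¬ ∀ u : ℝ, 0 ≤ u → u ≤ N →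
      |interp (walk (pad (twistedRow X (n + 1) ω))) (4 * u) -
        2 * interp (walk (pad (twistedRow X n ω))) u| ≤ x + 6} →
      ω ∈ row X (n + 1) ⁻¹' E₁ ∪ twistedRow X (n + 1) ⁻¹' E₂ := by
    filter_upwards [hX.ae_regular_row, hX.ae_isSigns_twistedRow] with ω hr hs
    contrapose
    intro hω
    simp only [Set.mem_union, not_or, Set.mem_preimage, hE₁, hE₂, Set.mem_ofPred_eq] at hω ⊢
    obtain ⟨hω1, hω2⟩ := hω
    push Not at hω1 hω2
    intro u hu huN
    rw [twistedRow_succ] at hω2 ⊢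
    exact abs_interp_twist_sub_le (hr (n + 1)) (hs n) hω1 hu (by linarith) fun q hq =>
      hω2 _ (Nat.floor_mono huN) q hq
  calc _ ≤ P.real (row X (n + 1) ⁻¹' E₁ ∪ twistedRow X (n + 1) ⁻¹' E₂) :=
        ENNReal.toReal_mono (measure_ne_top _ _) (measure_mono_ae hae)
    _ ≤ _ := (measureReal_union_le _ _).trans (by linarith)

end

end TwistShrink

namespace TwistShrink

open Filter Topology

/-! ### Summation of the step bounds -/

/-- The ratio `2 ^ (-1 / 2)` of the scales of consecutive approximations. -/
noncomputable def scaleRatio : ℝ := (2 : ℝ) ^ (-(1 / 2) : ℝ)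

lemma scaleRatio_pos : 0 < scaleRatio := by unfold scaleRatio; positivity

lemma scaleRatio_sq : scaleRatio ^ 2 = 1 / 2 := by
  rw [scaleRatio, ← Real.rpow_natCast, ← Real.rpow_mul (by norm_num)]
  norm_num

lemma scaleRatio_le : scaleRatio ≤ 0.7072 := by
  have := scaleRatio_sq
  have := scaleRatio_pos
  nlinarith

/-- A bound for the sum of the weights `scaleRatio ^ i * (2.0373 + 0.6935 i)`, `i ≥ j`. -/
noncomputable def tailWeight (j : ℕ) : ℝ := scaleRatio ^ j * (12.75 + 2.37 * j)

lemma tailWeight_nonneg (j : ℕ) : 0 ≤ tailWeight j := by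
  have := scaleRatio_pos
  unfold tailWeight
  positivity

/-- The weights are dominated by differences of `tailWeight`, so their sum telescopes. The constants
12.75 and 2.37 are admissible for any ratio up to 0.7072. -/
lemma le_tailWeight_sub (j : ℕ) :
    scaleRatio ^ j * (2.0373 + 0.6935 * j) ≤ tailWeight j - tailWeight (j + 1) := by
  have h1 := scaleRatio_le
  have h0 := scaleRatio_pos
  have hj : (0 : ℝ) ≤ j := Nat.cast_nonneg j
  have : tailWeight j - tailWeight (j + 1) = scaleRatio ^ j *
      ((12.75 + 2.37 * j) - scaleRatio * (12.75 + 2.37 * (j + 1))) := by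
    rw [tailWeight, tailWeight, pow_succ]
    push_cast
    ring
  rw [this]
  refine mul_le_mul_of_nonneg_left ?_ (by positivity)
  nlinarith [mul_nonneg hj (sub_nonneg.2 h1)]

lemma tendsto_tailWeight : Tendsto tailWeight atTop (𝓝 0) := by
  have hr : scaleRatio < 1 := lt_of_le_of_lt scaleRatio_le (by norm_num)
  have h1 := (tendsto_pow_atTop_nhds_zero_of_lt_one scaleRatio_pos.le hr).const_mul 12.75
  have h2 := (tendsto_self_mul_const_pow_of_lt_one scaleRatio_pos.le hr).const_mul 2.37
  have := h1.add h2
  simp only [mul_zero, add_zero] at this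
  refine this.congr fun j => ?_
  rw [tailWeight]
  ring

/-- The tangent line at `y = (3/2)^4`. It makes the logarithmic factor affine in `j`, hence summable
in closed form against a geometric weight. -/
lemma rpow_three_quarters_le {y : ℝ} (hy : 0 ≤ y) : y ^ (3 / 4 : ℝ) ≤ 27 / 32 + y / 2 := by
  have h := Real.geom_mean_le_arith_mean2_weighted (w₁ := 3 / 4) (w₂ := 1 / 4) (p₁ := y)
    (p₂ := (3 / 2) ^ 4) (by norm_num) (by norm_num) hy (by norm_num) (by norm_num)
  have h4 : (((3 / 2 : ℝ) ^ 4) ^ (1 / 4 : ℝ)) = 3 / 2 := by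
    rw [← Real.rpow_natCast, ← Real.rpow_mul (by norm_num)]
    norm_num
  rw [h4] at h
  norm_num at h ⊢
  linarith

/-- The number of steps of the `n`-th walk that correspond to the time interval `[0, K]`. -/
noncomputable def stepCount (K : ℝ≥0) (n : ℕ) : ℝ := (K : ℝ) * 2 ^ (2 * n)

lemma stepCount_add (K : ℝ≥0) (m j : ℕ) : stepCount K (m + j) = stepCount K m * 4 ^ j := by
  rw [stepCount, stepCount, mul_add, pow_add, pow_mul 2 2 j]
  norm_num
  ring

lemma stepCount_mono (K : ℝ≥0) : Monotone (stepCount K) := fun m n h => by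
  unfold stepCount
  gcongr
  norm_num

lemma tendsto_stepCount {K : ℝ≥0} (hK : 0 < K) : Tendsto (stepCount K) atTop atTop := by
  have h1 : Tendsto (fun n : ℕ => (4 : ℝ) ^ n) atTop atTop :=
    tendsto_pow_atTop_atTop_of_one_lt (by norm_num)
  refine (h1.const_mul_atTop (show (0 : ℝ) < K by exact_mod_cast hK)).congr fun n => ?_
  rw [stepCount, pow_mul]
  norm_num

/-- The order of magnitude of the distance between the `m`-th approximation and its limit. -/
noncomputable def errorScale (C : ℝ) (K : ℝ≥0) (m : ℕ) : ℝ :=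
  C * (max 1 (K : ℝ)) ^ (1 / 4 : ℝ) * logStar K ^ (3 / 4 : ℝ) * (m : ℝ) ^ (3 / 4 : ℝ) *
    (2 : ℝ) ^ (-(m : ℝ) / 2)

lemma one_le_logStar (x : ℝ) : 1 ≤ logStar x := le_max_left _ _

lemma errorScale_pos {C : ℝ} (hC : 0 < C) (K : ℝ≥0) {m : ℕ} (hm : 1 ≤ m) :
    0 < errorScale C K m := by
  have h1 := one_le_logStar K
  have h2 : (1 : ℝ) ≤ m := by exact_mod_cast hm
  have h3 : (1 : ℝ) ≤ max 1 (K : ℝ) := le_max_left _ _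
  unfold errorScale
  positivity

/-- Uses `2 log 2 < 1.3863` and `m + j ≤ m (1 + j)`; the dependence on `K` and `m` is separated from
that on `j`. -/
lemma log_stepCount_le {K : ℝ≥0} (hK : 0 < K) {m : ℕ} (hm : 1 ≤ m) (j : ℕ) :
    Real.log (stepCount K (m + j)) ≤ logStar K * m * (2.3863 + 1.3863 * j) := by
  have hK' : (K : ℝ) ≠ 0 := by exact_mod_cast hK.ne'
  rw [stepCount, Real.log_mul hK' (by positivity), Real.log_pow]
  have h1 := one_le_logStar K
  have h2 : (1 : ℝ) ≤ m := by exact_mod_cast hm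
  have h3 : Real.log K ≤ logStar K := le_max_right _ _
  have h4 := Real.log_two_lt_d9
  have h0 := Real.log_two_gt_d9
  have hj : (0 : ℝ) ≤ j := Nat.cast_nonneg j
  have h5 : logStar K ≤ logStar K * m := le_mul_of_one_le_right (by linarith) h2
  have h6 : (m : ℝ) ≤ logStar K * m := le_mul_of_one_le_left (by linarith) h1
  have h7 : (m : ℝ) + j ≤ logStar K * m * (1 + j) := by nlinarith
  have h8 : ((2 * (m + j) : ℕ) : ℝ) * Real.log 2 ≤ 1.3863 * (logStar K * m * (1 + j)) := by
    push_cast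
    nlinarith
  calc _ ≤ logStar K * m + 1.3863 * (logStar K * m * (1 + j)) := by linarith
    _ = _ := by ring

lemma stepBound_le {C : ℝ} (hC : 1 < C) {K : ℝ≥0} (hK : 0 < K) {m : ℕ} (hm : 1 ≤ m) (j : ℕ)
    (hN : LargeFor C (stepCount K (m + j))) :
    ((2 : ℝ) ^ (m + j + 1))⁻¹ * (spaceDev C (stepCount K (m + j)) + 6) ≤
      2.1 * errorScale C K m * (tailWeight j - tailWeight (j + 1)) := by
  set N := stepCount K (m + j) with hNdef
  set L := Real.log N with hL
  have hL1 : 1 ≤ L := hN.one_le_log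
  have hN0 := hN.pos
  have hℓ := one_le_logStar K
  have hm' : (1 : ℝ) ≤ m := by exact_mod_cast hm
  -- With `0.2 * 30 = 6`, the additive 6 is absorbed by raising the factor 4 of `spaceDev` to 4.2;
  -- the extra halving of the scale then gives 2.1.
  have hq : (30 : ℝ) ≤ N ^ (1 / 4 : ℝ) := by
    calc (30 : ℝ) = (30 ^ 4 : ℝ) ^ (1 / 4 : ℝ) := by
          rw [← Real.rpow_natCast, ← Real.rpow_mul (by norm_num)]
          norm_num
      _ ≤ N ^ (1 / 4 : ℝ) := Real.rpow_le_rpow (by norm_num) (by linarith [hN.le]) (by norm_num)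
  have hCL : 1 ≤ (C * L) ^ (3 / 4 : ℝ) := Real.one_le_rpow (by nlinarith) (by norm_num)
  have h1 : spaceDev C N + 6 ≤ 4.2 * (C * L) ^ (3 / 4 : ℝ) * N ^ (1 / 4 : ℝ) := by
    rw [spaceDev]
    nlinarith
  have h2 : (C * L) ^ (3 / 4 : ℝ) ≤ C * L ^ (3 / 4 : ℝ) := by
    rw [Real.mul_rpow (by linarith) (by linarith)]
    refine mul_le_mul_of_nonneg_right ?_ (by positivity)
    calc C ^ (3 / 4 : ℝ) ≤ C ^ (1 : ℝ) :=
          Real.rpow_le_rpow_of_exponent_le hC.le (by norm_num)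
      _ = C := Real.rpow_one C
  have hy : (0 : ℝ) ≤ 2.3863 + 1.3863 * j := by positivity
  have h3 : L ^ (3 / 4 : ℝ) ≤
      logStar K ^ (3 / 4 : ℝ) * (m : ℝ) ^ (3 / 4 : ℝ) * (2.0373 + 0.6935 * j) := by
    calc L ^ (3 / 4 : ℝ) ≤ (logStar K * m * (2.3863 + 1.3863 * j)) ^ (3 / 4 : ℝ) :=
          Real.rpow_le_rpow (by linarith) (log_stepCount_le hK hm j) (by norm_num)
      _ = logStar K ^ (3 / 4 : ℝ) * (m : ℝ) ^ (3 / 4 : ℝ) *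
            (2.3863 + 1.3863 * j) ^ (3 / 4 : ℝ) := by
          rw [Real.mul_rpow (by positivity) hy, Real.mul_rpow (by positivity) (by positivity)]
      _ ≤ _ := by
          refine mul_le_mul_of_nonneg_left ((rpow_three_quarters_le hy).trans ?_) (by positivity)
          have : (0 : ℝ) ≤ j := Nat.cast_nonneg j
          norm_num
          linarith
  have h4 : N ^ (1 / 4 : ℝ) ≤ max 1 (K : ℝ) ^ (1 / 4 : ℝ) * (2 : ℝ) ^ (((m + j : ℕ) : ℝ) / 2) := by
    rw [hNdef, stepCount, Real.mul_rpow (by positivity) (by positivity), ← Real.rpow_natCast 2,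
      ← Real.rpow_mul (by norm_num)]
    have : ((2 * (m + j) : ℕ) : ℝ) * (1 / 4) = ((m + j : ℕ) : ℝ) / 2 := by
      push_cast
      ring
    rw [this]
    gcongr
    exact le_max_right _ _
  have h5 : ((2 : ℝ) ^ (m + j + 1))⁻¹ * (2 : ℝ) ^ (((m + j : ℕ) : ℝ) / 2) =
      1 / 2 * ((2 : ℝ) ^ (-(m : ℝ) / 2) * scaleRatio ^ j) := by
    rw [scaleRatio, ← Real.rpow_natCast 2, ← Real.rpow_natCast _ j, ← Real.rpow_mul (by norm_num),
      ← Real.rpow_neg (by norm_num), ← Real.rpow_add (by norm_num), ← Real.rpow_add (by norm_num),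
      one_div, ← Real.rpow_neg_one 2, ← Real.rpow_add (by norm_num)]
    congr 1
    push_cast
    ring
  calc ((2 : ℝ) ^ (m + j + 1))⁻¹ * (spaceDev C N + 6)
      ≤ ((2 : ℝ) ^ (m + j + 1))⁻¹ * (4.2 *
        (C * (logStar K ^ (3 / 4 : ℝ) * (m : ℝ) ^ (3 / 4 : ℝ) * (2.0373 + 0.6935 * j))) *
        (max 1 (K : ℝ) ^ (1 / 4 : ℝ) * (2 : ℝ) ^ (((m + j : ℕ) : ℝ) / 2))) := by
        refine mul_le_mul_of_nonneg_left (h1.trans ?_) (by positivity)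
        refine mul_le_mul (mul_le_mul_of_nonneg_left (h2.trans ?_) (by norm_num)) h4
          (by positivity) (by positivity)
        exact mul_le_mul_of_nonneg_left h3 (by linarith)
    _ = (((2 : ℝ) ^ (m + j + 1))⁻¹ * (2 : ℝ) ^ (((m + j : ℕ) : ℝ) / 2)) * (4.2 *
        (C * (logStar K ^ (3 / 4 : ℝ) * (m : ℝ) ^ (3 / 4 : ℝ) * (2.0373 + 0.6935 * j))) *
        max 1 (K : ℝ) ^ (1 / 4 : ℝ)) := by ring
    _ = 2.1 * errorScale C K m * (scaleRatio ^ j * (2.0373 + 0.6935 * j)) := by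
        rw [h5, errorScale]
        ring
    _ ≤ _ := mul_le_mul_of_nonneg_left (le_tailWeight_sub j)
        (mul_nonneg (by norm_num) (errorScale_pos (by linarith) K hm).le)

/-! ### The limit process -/

section

variable {Ω : Type*} {X : ℕ → ℕ → Ω → ℝ}

lemma approx_eq (X : ℕ → ℕ → Ω → ℝ) (m : ℕ) (t : ℝ≥0) (ω : Ω) :
    approx X m t ω = ((2 : ℝ) ^ m)⁻¹ *
      interp (walk (pad (twistedRow X m ω))) ((t : ℝ) * (2 : ℝ) ^ (2 * m)) := by
  rw [approx, walk_twistedStep]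

/-- From the `m`-th on, consecutive twisted walks stay close on `[0, K]`. -/
def StepsClose (X : ℕ → ℕ → Ω → ℝ) (C : ℝ) (K : ℝ≥0) (m : ℕ) (ω : Ω) : Prop :=
  ∀ j : ℕ, ∀ u : ℝ, 0 ≤ u → u ≤ stepCount K (m + j) →
    |interp (walk (pad (twistedRow X (m + j + 1) ω))) (4 * u) -
      2 * interp (walk (pad (twistedRow X (m + j) ω))) u| ≤
        spaceDev C (stepCount K (m + j)) + 6

/-- The almost sure limit of the approximations. -/
noncomputable def limitPath (X : ℕ → ℕ → Ω → ℝ) (t : ℝ≥0) (ω : Ω) : ℝ :=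
  limUnder atTop fun m => approx X m t ω

namespace StepsClose

variable {C : ℝ} {K : ℝ≥0} {m : ℕ} {ω : Ω}

lemma abs_approx_sub_le (h : StepsClose X C K m ω) (hC : 1 < C) (hK : 0 < K) (hm : 1 ≤ m)
    (hN : ∀ j, LargeFor C (stepCount K (m + j))) {t : ℝ≥0} (ht : t ≤ K) (j : ℕ) :
    |approx X (m + (j + 1)) t ω - approx X (m + j) t ω| ≤
      2.1 * errorScale C K m * (tailWeight j - tailWeight (j + 1)) := by
  refine le_trans ?_ (stepBound_le hC hK hm j (hN j))
  have ht' : (t : ℝ) ≤ K := by exact_mod_cast ht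
  have h1 := h j ((t : ℝ) * 2 ^ (2 * (m + j))) (by positivity)
    (mul_le_mul_of_nonneg_right ht' (by positivity))
  have h2 : approx X (m + (j + 1)) t ω - approx X (m + j) t ω = ((2 : ℝ) ^ (m + j + 1))⁻¹ *
      (interp (walk (pad (twistedRow X (m + j + 1) ω))) (4 * ((t : ℝ) * 2 ^ (2 * (m + j)))) -
        2 * interp (walk (pad (twistedRow X (m + j) ω))) ((t : ℝ) * 2 ^ (2 * (m + j)))) := by
    rw [approx_eq, approx_eq, ← add_assoc,
      show (t : ℝ) * 2 ^ (2 * (m + j + 1)) = 4 * ((t : ℝ) * 2 ^ (2 * (m + j))) by ring, mul_sub,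
      pow_succ]
    field_simp
  rw [h2, abs_mul, abs_of_nonneg (by positivity)]
  exact mul_le_mul_of_nonneg_left h1 (by positivity)

lemma abs_approx_add_sub_le (h : StepsClose X C K m ω) (hC : 1 < C) (hK : 0 < K) (hm : 1 ≤ m)
    (hN : ∀ j, LargeFor C (stepCount K (m + j))) {t : ℝ≥0} (ht : t ≤ K) {j i : ℕ} (hji : j ≤ i) :
    |approx X (m + i) t ω - approx X (m + j) t ω| ≤
      2.1 * errorScale C K m * (tailWeight j - tailWeight i) := by
  induction i, hji using Nat.le_induction with
  | base => simp
  | succ i hi ih =>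
    have h1 := h.abs_approx_sub_le hC hK hm hN ht i
    rw [abs_le] at *
    constructor <;> linarith [h1.1, h1.2, ih.1, ih.2]

lemma abs_approx_add_sub_le' (h : StepsClose X C K m ω) (hC : 1 < C) (hK : 0 < K) (hm : 1 ≤ m)
    (hN : ∀ j, LargeFor C (stepCount K (m + j))) {t : ℝ≥0} (ht : t ≤ K) {j i : ℕ} (hji : j ≤ i) :
    |approx X (m + i) t ω - approx X (m + j) t ω| ≤ 2.1 * errorScale C K m * tailWeight j := by
  refine (h.abs_approx_add_sub_le hC hK hm hN ht hji).trans ?_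
  refine mul_le_mul_of_nonneg_left ?_
    (mul_nonneg (by norm_num) (errorScale_pos (by linarith) K hm).le)
  linarith [tailWeight_nonneg i]

lemma tendsto_limitPath (h : StepsClose X C K m ω) (hC : 1 < C) (hK : 0 < K) (hm : 1 ≤ m)
    (hN : ∀ j, LargeFor C (stepCount K (m + j))) {t : ℝ≥0} (ht : t ≤ K) :
    Tendsto (fun n => approx X n t ω) atTop (𝓝 (limitPath X t ω)) := by
  refine tendsto_nhds_limUnder ?_
  have hcau : CauchySeq fun j => approx X (m + j) t ω := by
    refine cauchySeq_of_le_tendsto_0' (fun j => 2.1 * errorScale C K m * tailWeight j)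
      (fun j i hji => ?_) (by simpa using tendsto_tailWeight.const_mul (2.1 * errorScale C K m))
    rw [dist_comm, Real.dist_eq]
    exact h.abs_approx_add_sub_le' hC hK hm hN ht hji
  obtain ⟨x, hx⟩ := cauchySeq_tendsto_of_complete hcau
  refine ⟨x, ?_⟩
  rw [← tendsto_add_atTop_iff_nat m]
  simpa only [add_comm] using hx

/-- The distance between the limit and the approximations. -/
lemma abs_limitPath_sub_le (h : StepsClose X C K m ω) (hC : 1 < C) (hK : 0 < K) (hm : 1 ≤ m)
    (hN : ∀ j, LargeFor C (stepCount K (m + j))) {t : ℝ≥0} (ht : t ≤ K) (j : ℕ) :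
    |limitPath X t ω - approx X (m + j) t ω| ≤ 2.1 * errorScale C K m * tailWeight j := by
  have hlim := h.tendsto_limitPath hC hK hm hN ht
  rw [← tendsto_add_atTop_iff_nat m] at hlim
  refine le_of_tendsto ((hlim.sub_const (approx X (m + j) t ω)).abs) ?_
  filter_upwards [eventually_ge_atTop j] with i hi
  rw [add_comm i m]
  exact h.abs_approx_add_sub_le' hC hK hm hN ht hi

lemma tendstoUniformlyOn (h : StepsClose X C K m ω) (hC : 1 < C) (hK : 0 < K) (hm : 1 ≤ m)
    (hN : ∀ j, LargeFor C (stepCount K (m + j))) :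
    TendstoUniformlyOn (fun (n : ℕ) (t : ℝ≥0) => approx X n t ω)
      (fun t => limitPath X t ω) atTop (Set.Iic K) := by
  rw [Metric.tendstoUniformlyOn_iff]
  intro ε hε
  have hlim : Tendsto (fun j => 2.1 * errorScale C K m * tailWeight j) atTop (𝓝 0) := by
    simpa using tendsto_tailWeight.const_mul (2.1 * errorScale C K m)
  have hev := hlim.eventually (gt_mem_nhds hε)
  obtain ⟨j₀, hj₀⟩ := eventually_atTop.1 hev
  filter_upwards [eventually_ge_atTop (m + j₀)] with n hn t ht
  obtain ⟨j, rfl⟩ := Nat.exists_eq_add_of_le (show m ≤ n by omega)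
  exact (h.abs_limitPath_sub_le hC hK hm hN ht j).trans_lt (hj₀ j (by omega))

end StepsClose

end

section

variable {Ω : Type*} [MeasurableSpace Ω] {P : Measure Ω} [IsProbabilityMeasure P]
  {X : ℕ → ℕ → Ω → ℝ}

/-- The probability that consecutive twisted walks are ever far apart from the `m`-th on. -/
theorem IsSignMatrix.tail_stepsClose (hX : IsSignMatrix P X) {C : ℝ} (hC : 1 < C) {K : ℝ≥0}
    {m : ℕ} (hN : ∀ j, LargeFor C (stepCount K (m + j))) :
    P.real {ω | ¬ StepsClose X C K m ω} ≤
      2 / (1 - (4 : ℝ) ^ (1 - C)) * stepCount K m ^ (1 - C) := by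
  have hN0 : 0 < stepCount K m := (hN 0).pos
  have hr0 : (0 : ℝ) ≤ 4 ^ (1 - C) := by positivity
  have hr1 : (4 : ℝ) ^ (1 - C) < 1 := Real.rpow_lt_one_of_one_lt_of_neg (by norm_num) (by linarith)
  -- Each level multiplies the number of steps by 4, so the failure probabilities are geometric.
  have hterm : ∀ j, 2 * stepCount K (m + j) ^ (1 - C) =
      2 * stepCount K m ^ (1 - C) * ((4 : ℝ) ^ (1 - C)) ^ j := fun j => by
    rw [stepCount_add, Real.mul_rpow hN0.le (by positivity), ← Real.rpow_natCast,
      ← Real.rpow_natCast, ← Real.rpow_mul (by norm_num), ← Real.rpow_mul (by norm_num),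
      mul_comm (j : ℝ)]
    ring
  have hsum := (hasSum_geometric_of_lt_one hr0 hr1).mul_left (2 * stepCount K m ^ (1 - C))
  have hset : {ω | ¬ StepsClose X C K m ω} = ⋃ j, {ω | ¬ ∀ u : ℝ, 0 ≤ u →
      u ≤ stepCount K (m + j) → |interp (walk (pad (twistedRow X (m + j + 1) ω))) (4 * u) -
      2 * interp (walk (pad (twistedRow X (m + j) ω))) u| ≤
        spaceDev C (stepCount K (m + j)) + 6} := by
    ext ω
    simp only [StepsClose, Set.mem_ofPred_eq, Set.mem_iUnion, not_forall]
  have hle : P {ω | ¬ StepsClose X C K m ω} ≤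
      ENNReal.ofReal (2 * stepCount K m ^ (1 - C) * (1 - (4 : ℝ) ^ (1 - C))⁻¹) := by
    rw [hset, ← hsum.tsum_eq, ENNReal.ofReal_tsum_of_nonneg (fun j => by positivity) hsum.summable]
    refine (measure_iUnion_le _).trans (ENNReal.tsum_le_tsum fun j => ?_)
    rw [← hterm, ← ofReal_measureReal]
    exact ENNReal.ofReal_le_ofReal (hX.tail_step hC (hN j) (m + j))
  have hnn : 0 ≤ 2 * stepCount K m ^ (1 - C) * (1 - (4 : ℝ) ^ (1 - C))⁻¹ :=
    mul_nonneg (by positivity) (inv_nonneg.2 (by linarith))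
  calc P.real {ω | ¬ StepsClose X C K m ω} ≤ _ := ENNReal.toReal_le_of_le_ofReal hnn hle
    _ = _ := by ring

lemma eventually_forall_largeFor {C : ℝ} {K : ℝ≥0} (hK : 0 < K) :
    ∀ᶠ m : ℕ in atTop, ∀ j, LargeFor C (stepCount K (m + j)) := by
  obtain ⟨N₀, hN₀⟩ := eventually_atTop.1 (eventually_largeFor C)
  filter_upwards [(tendsto_stepCount hK).eventually_ge_atTop N₀] with m hm j
  exact hN₀ _ (hm.trans (stepCount_mono K (Nat.le_add_right m j)))

/-- The exceptional set lies in the failure event of every large `m`, whose probability tends to 0.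
-/
lemma IsSignMatrix.ae_exists_stepsClose (hX : IsSignMatrix P X) {C : ℝ} (hC : 1 < C) {K : ℝ≥0}
    (hK : 0 < K) : ∀ᵐ ω ∂P, ∃ m, 1 ≤ m ∧ (∀ j, LargeFor C (stepCount K (m + j))) ∧
      StepsClose X C K m ω := by
  rw [ae_iff, ← measureReal_eq_zero_iff]
  refine le_antisymm ?_ measureReal_nonneg
  have hlim : Tendsto (fun m => 2 / (1 - (4 : ℝ) ^ (1 - C)) * stepCount K m ^ (1 - C)) atTop
      (𝓝 (2 / (1 - (4 : ℝ) ^ (1 - C)) * 0)) := by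
    refine Tendsto.const_mul _ ?_
    have h2 := (tendsto_rpow_neg_atTop (show 0 < C - 1 by linarith)).comp (tendsto_stepCount hK)
    refine h2.congr fun m => ?_
    simp [neg_sub]
  rw [mul_zero] at hlim
  refine ge_of_tendsto hlim ?_
  filter_upwards [eventually_forall_largeFor (C := C) hK, eventually_ge_atTop 1] with m hm h1
  refine (measureReal_mono fun ω hω => ?_).trans (hX.tail_stepsClose hC hm)
  exact fun hcl => hω ⟨m, h1, hm, hcl⟩

/-- Almost sure locally uniform convergence of the approximations. -/
theorem IsSignMatrix.ae_tendstoUniformlyOn (hX : IsSignMatrix P X) :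
    ∀ᵐ ω ∂P, ∀ K : ℝ≥0, TendstoUniformlyOn (fun (m : ℕ) (t : ℝ≥0) => approx X m t ω)
      (fun t => limitPath X t ω) atTop (Set.Iic K) := by
  -- Any `C > 1` would do; integer horizons leave only countably many null sets.
  have h : ∀ k : ℕ, ∀ᵐ ω ∂P, ∃ m, 1 ≤ m ∧ (∀ j, LargeFor 2 (stepCount (k + 1) (m + j))) ∧
      StepsClose X 2 (k + 1) m ω := fun k => hX.ae_exists_stepsClose (by norm_num) (by positivity)
  filter_upwards [ae_all_iff.2 h] with ω hω K
  obtain ⟨k, hk⟩ := exists_nat_ge K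
  obtain ⟨m, hm, hN, hcl⟩ := hω k
  refine (hcl.tendstoUniformlyOn (by norm_num) (by positivity) hm hN).mono ?_
  exact Set.Iic_subset_Iic.2 (hk.trans (by simp))

lemma IsSignMatrix.ae_tendsto (hX : IsSignMatrix P X) :
    ∀ᵐ ω ∂P, ∀ t, Tendsto (fun m => approx X m t ω) atTop (𝓝 (limitPath X t ω)) := by
  filter_upwards [hX.ae_tendstoUniformlyOn] with ω h t
  exact (h t).tendsto_at Set.self_mem_Iic

lemma IsSignMatrix.ae_continuous (hX : IsSignMatrix P X) :
    ∀ᵐ ω ∂P, Continuous fun t => limitPath X t ω := by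
  filter_upwards [hX.ae_tendstoUniformlyOn, hX.ae_isSigns_twistedRow] with ω h hs
  have hloc : TendstoLocallyUniformly (fun (m : ℕ) (t : ℝ≥0) => approx X m t ω)
      (fun t => limitPath X t ω) atTop := by
    rw [tendstoLocallyUniformly_iff_forall_tendsto]
    intro t
    have := tendstoUniformlyOn_iff_tendsto.1 (h (t + 1))
    refine this.mono_left (Filter.prod_mono le_rfl ?_)
    exact le_principal_iff.2 (Iic_mem_nhds (by simp))
  refine hloc.continuous (Frequently.of_forall fun m => ?_)
  simp only [approx_eq]
  refine continuous_const.mul ?_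
  refine (continuousOn_interp (hs m).abs_walk_step).comp_continuous (by fun_prop) fun t => ?_
  rw [Set.mem_Ici]
  positivity

/-- The probability of a large uniform distance between the limit and the approximations. -/
theorem IsSignMatrix.tail_limitPath (hX : IsSignMatrix P X) {C : ℝ} (hC : 1 < C) {K : ℝ≥0}
    (hK : 0 < K) {m : ℕ} (hm : 1 ≤ m) (hN : ∀ j, LargeFor C (stepCount K (m + j))) :
    P.real {ω | 27 * errorScale C K m ≤
        ⨆ t : Set.Iic K, |limitPath X (t : ℝ≥0) ω - approx X m (t : ℝ≥0) ω|} ≤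
      2 / (1 - (4 : ℝ) ^ (1 - C)) * stepCount K m ^ (1 - C) := by
  refine (measureReal_mono fun ω hω => ?_).trans (hX.tail_stepsClose hC hN)
  intro hcl
  have hpos := errorScale_pos (show 0 < C by linarith) K hm
  have hsup : ⨆ t : Set.Iic K, |limitPath X (t : ℝ≥0) ω - approx X m (t : ℝ≥0) ω| ≤
      2.1 * errorScale C K m * tailWeight 0 :=
    Real.iSup_le (fun t => hcl.abs_limitPath_sub_le hC hK hm hN t.2 0)
      (mul_nonneg (by positivity) (tailWeight_nonneg 0))
  have h0 : tailWeight 0 = 12.75 := by simp [tailWeight]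
  rw [h0] at hsup
  -- `2.1 * 12.75 = 26.775 < 27`, a contradiction since `errorScale` is positive.
  have := hω.out.trans hsup
  norm_num at this
  linarith

end

end TwistShrink

namespace TwistShrink

open Filter Topology

/-! ### Characteristic functions -/

lemma coin_integral_exp (F : Finset ℕ) (c : ℕ → ℝ) :
    ∫ s, Complex.exp ((∑ k ∈ F, c k * s k : ℝ) * Complex.I) ∂coinMeasure =
      ∏ k ∈ F, (Real.cos (c k) : ℂ) := by
  have hi : iIndepFun (fun (k : F) (s : ℕ → ℝ) => s k) coinMeasure :=
    iIndepFun_coin.precomp Subtype.val_injective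
  have hi' : iIndepFun (fun (k : F) (s : ℕ → ℝ) => Complex.exp ((c k * s k : ℝ) * Complex.I))
      coinMeasure :=
    hi.comp (fun (k : F) (x : ℝ) => Complex.exp ((c k * x : ℝ) * Complex.I))
      fun k => by fun_prop
  have hmeas : ∀ k : F, Continuous fun s : ℕ → ℝ =>
      Complex.exp ((c k * s k : ℝ) * Complex.I) := fun k => by fun_prop
  have h1 := hi'.integral_fun_prod_eq_prod_integral
    fun k => (hmeas k).measurable.aestronglyMeasurable
  have h2 : ∀ k : ℕ, ∫ s, Complex.exp ((c k * s k : ℝ) * Complex.I) ∂coinMeasure =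
      (Real.cos (c k) : ℂ) := by
    intro k
    have h3 := (measurePreserving_eval_coin k).map_eq
    have h4 : ∫ s, Complex.exp ((c k * s k : ℝ) * Complex.I) ∂coinMeasure =
        ∫ x, Complex.exp ((c k * x : ℝ) * Complex.I) ∂signMeasure := by
      rw [← h3, integral_map (measurable_pi_apply k).aemeasurable (by fun_prop)]
    rw [h4, integral_signMeasure, Complex.ofReal_cos, Complex.cos]
    push_cast
    ring_nf
  rw [← Finset.prod_coe_sort F]
  simp only [← h2]
  rw [← h1]
  refine integral_congr_ae (Eventually.of_forall fun s => ?_)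
  dsimp only
  rw [← Complex.exp_sum, ← Finset.sum_mul, ← Finset.sum_coe_sort F]
  push_cast
  rfl

lemma coin_integral_exp_blocks {ι : Type*} [Fintype ι] (I : ι → Finset ℕ)
    (hI : Pairwise (Function.onFun Disjoint I)) (e : ι → ℝ) :
    ∫ s, Complex.exp ((∑ i, e i * ∑ k ∈ I i, s k : ℝ) * Complex.I) ∂coinMeasure =
      ∏ i, ((Real.cos (e i) ^ (I i).card : ℝ) : ℂ) := by
  classical
  -- By disjointness at most one term is nonzero, so `c` equals `e i` on the block `I i`.
  let c : ℕ → ℝ := fun k => ∑ i, if k ∈ I i then e i else 0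
  have hc : ∀ i, ∀ k ∈ I i, c k = e i := by
    intro i k hk
    rw [show c k = ∑ j, if k ∈ I j then e j else 0 from rfl,
      Finset.sum_eq_single i (fun j _ hji => ?_) (by simp), if_pos hk]
    rw [if_neg fun hkj => Finset.disjoint_left.1 (hI hji) hkj hk]
  have h := coin_integral_exp (Finset.univ.biUnion I) c
  rw [Finset.prod_biUnion (fun i _ j _ hij => hI hij)] at h
  have hprod : ∀ i, ∏ k ∈ I i, (Real.cos (c k) : ℂ) = ((Real.cos (e i) ^ (I i).card : ℝ) : ℂ) := by
    intro i
    have hcos : ∀ k ∈ I i, (Real.cos (c k) : ℂ) = Real.cos (e i) := fun k hk => by rw [hc i k hk]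
    rw [Finset.prod_congr rfl hcos, Finset.prod_const]
    push_cast
    rfl
  simp only [hprod] at h
  rw [← h]
  refine integral_congr_ae (Eventually.of_forall fun s => ?_)
  dsimp only
  rw [Finset.sum_biUnion (fun i _ j _ hij => hI hij)]
  have hsum : ∑ i, e i * ∑ k ∈ I i, s k = ∑ i, ∑ k ∈ I i, c k * s k := by
    refine Finset.sum_congr rfl fun i _ => ?_
    rw [Finset.mul_sum]
    exact Finset.sum_congr rfl fun k hk => by rw [hc i k hk]
  rw [hsum]

lemma tendsto_mul_cos_sub_one (e : ℝ) :
    Tendsto (fun n : ℕ => (n : ℝ) * (Real.cos (e / √n) - 1)) atTop (𝓝 (-(e ^ 2 / 2))) := by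
  rw [tendsto_iff_norm_sub_tendsto_zero]
  have hlim : Tendsto (fun n : ℕ => e ^ 4 * (5 / 96) / (n : ℝ)) atTop (𝓝 0) :=
    tendsto_const_div_atTop_nhds_zero_nat _
  refine squeeze_zero' (Eventually.of_forall fun n => norm_nonneg _) ?_ hlim
  filter_upwards [eventually_ge_atTop (⌈e ^ 2⌉₊ + 1)] with n hn
  have hn1 : (1 : ℝ) ≤ n := by exact_mod_cast (by omega : 1 ≤ n)
  have hn0 : (0 : ℝ) < n := by linarith
  have hne : e ^ 2 ≤ n := by
    have h1 := Nat.le_ceil (e ^ 2)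
    have h2 : ((⌈e ^ 2⌉₊ + 1 : ℕ) : ℝ) ≤ n := by exact_mod_cast hn
    push_cast at h2
    linarith
  have hsq : (e / √n) ^ 2 = e ^ 2 / n := by rw [div_pow, Real.sq_sqrt hn0.le]
  have habs : |e / √n| ≤ 1 := by
    rw [← sq_le_one_iff_abs_le_one, hsq, div_le_one hn0]
    exact hne
  have hb := Real.cos_bound habs
  have h4 : |e / √n| ^ 4 = e ^ 4 / n ^ 2 := by
    rw [show |e / √n| ^ 4 = (|e / √n| ^ 2) ^ 2 by ring, sq_abs, hsq]
    ring
  rw [h4, hsq] at hb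
  have h5 : (n : ℝ) * (Real.cos (e / √n) - 1) - -(e ^ 2 / 2) =
      n * (Real.cos (e / √n) - (1 - e ^ 2 / n / 2)) := by
    field_simp
    ring
  rw [h5, Real.norm_eq_abs, abs_mul, abs_of_pos hn0]
  calc (n : ℝ) * |Real.cos (e / √n) - (1 - e ^ 2 / n / 2)| ≤ n * (e ^ 4 / n ^ 2 * (5 / 96)) :=
        mul_le_mul_of_nonneg_left hb hn0.le
    _ = e ^ 4 * (5 / 96) / n := by field_simp

/-- Powers of cosines converge to the characteristic function of a centered normal law. -/
lemma tendsto_cos_pow (e : ℝ) {p : ℕ → ℕ} {d : ℝ}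
    (hp : Tendsto (fun m => (p m : ℝ) / 4 ^ m) atTop (𝓝 d)) :
    Tendsto (fun m => Real.cos (e * ((2 : ℝ) ^ m)⁻¹) ^ p m) atTop
      (𝓝 (Real.exp (-(e ^ 2 / 2) * d))) := by
  -- Along `n = 4^m` one has `√n = 2^m`. The power is written as the exponential of `4^m log cos`
  -- times `p m / 4^m`, once the cosine is positive.
  have h4 : Tendsto (fun m : ℕ => 4 ^ m) atTop atTop := tendsto_pow_atTop_atTop_of_one_lt (by norm_num)
  have h1 := (Real.tendsto_nat_mul_log_one_add_of_tendsto (tendsto_mul_cos_sub_one e)).comp h4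
  have hsqrt : ∀ m : ℕ, √((4 ^ m : ℕ) : ℝ) = 2 ^ m := fun m => by
    rw [show ((4 ^ m : ℕ) : ℝ) = (2 ^ m) ^ 2 by push_cast; rw [← pow_mul, mul_comm, pow_mul]; norm_num]
    exact Real.sqrt_sq (by positivity)
  have hcos : Tendsto (fun m : ℕ => Real.cos (e * ((2 : ℝ) ^ m)⁻¹)) atTop (𝓝 1) := by
    have h2 : Tendsto (fun m : ℕ => e * ((2 : ℝ) ^ m)⁻¹) atTop (𝓝 (e * 0)) :=
      (tendsto_inv_atTop_zero.comp (tendsto_pow_atTop_atTop_of_one_lt (by norm_num))).const_mul e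
    have h3 := (Real.continuous_cos.tendsto (e * 0)).comp h2
    rwa [mul_zero, Real.cos_zero] at h3
  have h5 := (Real.continuous_exp.tendsto _).comp (h1.mul hp)
  refine h5.congr' ?_
  filter_upwards [hcos.eventually (lt_mem_nhds (show (0 : ℝ) < 1 by norm_num))] with m hm
  simp only [Function.comp_apply, hsqrt, ← div_eq_mul_inv] at hm ⊢
  rw [add_sub_cancel, ← Real.rpow_natCast (Real.cos _), Real.rpow_def_of_pos hm]
  congr 1
  push_cast
  field_simp

/-- The number of steps up to time `t` at scale `m`, relative to `4 ^ m`. -/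
lemma tendsto_floor_div (t : ℝ≥0) :
    Tendsto (fun m : ℕ => (⌊(t : ℝ) * 2 ^ (2 * m)⌋₊ : ℝ) / 4 ^ m) atTop (𝓝 t) := by
  have h4 : Tendsto (fun m : ℕ => (4 : ℝ) ^ m) atTop atTop :=
    tendsto_pow_atTop_atTop_of_one_lt (by norm_num)
  refine ((tendsto_nat_floor_mul_div_atTop t.2).comp h4).congr fun m => ?_
  simp only [Function.comp_apply, pow_mul]
  norm_num

lemma limitPath_zero {Ω : Type*} (X : ℕ → ℕ → Ω → ℝ) (ω : Ω) : limitPath X 0 ω = 0 := by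
  have : (fun m => approx X m 0 ω) = fun _ => 0 := by
    funext m
    simp [approx_eq, interp]
  rw [limitPath, this]
  exact tendsto_const_nhds.limUnder_eq

section

variable {Ω : Type*} [MeasurableSpace Ω] {P : Measure Ω} {X : ℕ → ℕ → Ω → ℝ}

/-- The `m`-th approximation, sampled at the last step before time `t`. -/
noncomputable def stepApprox (X : ℕ → ℕ → Ω → ℝ) (m : ℕ) (t : ℝ≥0) (ω : Ω) : ℝ :=
  ((2 : ℝ) ^ m)⁻¹ * walk (pad (twistedRow X m ω)) ⌊(t : ℝ) * 2 ^ (2 * m)⌋₊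

lemma IsSignMatrix.measurable_stepApprox (hX : IsSignMatrix P X) (m : ℕ) (t : ℝ≥0) :
    Measurable (stepApprox X m t) :=
  ((measurable_walk_pad _).comp (hX.measurable_twistedRow m)).const_mul _

variable [IsProbabilityMeasure P]

lemma IsSignMatrix.ae_tendsto_stepApprox (hX : IsSignMatrix P X) :
    ∀ᵐ ω ∂P, ∀ t, Tendsto (fun m => stepApprox X m t ω) atTop (𝓝 (limitPath X t ω)) := by
  filter_upwards [hX.ae_tendsto, hX.ae_isSigns_twistedRow] with ω h hs t
  have hz : Tendsto (fun m => approx X m t ω - stepApprox X m t ω) atTop (𝓝 0) := by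
    refine squeeze_zero_norm (a := fun m : ℕ => ((2 : ℝ) ^ m)⁻¹) (fun m => ?_)
      (tendsto_inv_atTop_zero.comp (tendsto_pow_atTop_atTop_of_one_lt (by norm_num)))
    rw [approx_eq, stepApprox, ← mul_sub, Real.norm_eq_abs, abs_mul, abs_of_nonneg (by positivity)]
    refine mul_le_of_le_one_right (by positivity) ?_
    refine (abs_interp_sub_le_of_floor (hs m).abs_walk_step (by positivity)).trans ?_
    linarith [Nat.lt_floor_add_one ((t : ℝ) * 2 ^ (2 * m))]
  have := (h t).sub hz
  simpa using this

lemma IsSignMatrix.aemeasurable_limitPath (hX : IsSignMatrix P X) (t : ℝ≥0) :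
    AEMeasurable (limitPath X t) P := by
  refine aemeasurable_of_tendsto_metrizable_ae atTop
    (fun m => (hX.measurable_stepApprox m t).aemeasurable) ?_
  filter_upwards [hX.ae_tendsto_stepApprox] with ω h using h t

/-- The joint characteristic function of increments of the limit over disjoint intervals. -/
theorem IsSignMatrix.integral_exp_increments (hX : IsSignMatrix P X) {ι : Type*} [Fintype ι]
    {a b : ι → ℝ≥0} (hab : ∀ i, a i ≤ b i) (hdis : ∀ i j, i ≠ j → b i ≤ a j ∨ b j ≤ a i)
    (e : ι → ℝ) :
    ∫ ω, Complex.exp ((∑ i, e i * (limitPath X (b i) ω - limitPath X (a i) ω) : ℝ) *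
        Complex.I) ∂P =
      ∏ i, ((Real.exp (-(e i ^ 2 / 2) * (b i - a i)) : ℝ) : ℂ) := by
  have hmono : ∀ m, Monotone fun t : ℝ≥0 => ⌊(t : ℝ) * 2 ^ (2 * m)⌋₊ := fun m s t hst =>
    Nat.floor_mono (mul_le_mul_of_nonneg_right (by exact_mod_cast hst) (by positivity))
  let I : ℕ → ι → Finset ℕ := fun m i =>
    Finset.Ico ⌊(a i : ℝ) * 2 ^ (2 * m)⌋₊ ⌊(b i : ℝ) * 2 ^ (2 * m)⌋₊
  have hIdis : ∀ m, Pairwise (Function.onFun Disjoint (I m)) := by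
    intro m i j hij
    rw [Function.onFun, Finset.disjoint_left]
    intro k hk hk'
    simp only [I, Finset.mem_Ico] at hk hk'
    rcases hdis i j hij with h | h
    · have := hmono m h
      dsimp only at this
      omega
    · have := hmono m h
      dsimp only at this
      omega
  -- The twisted row has the law of fair signs, and each increment is a scaled sum over the block `I
  -- m i`.
  have hstep : ∀ m, ∫ ω, Complex.exp ((∑ i, e i * (stepApprox X m (b i) ω -
      stepApprox X m (a i) ω) : ℝ) * Complex.I) ∂P =
      ∏ i, ((Real.cos (e i * ((2 : ℝ) ^ m)⁻¹) ^ (I m i).card : ℝ) : ℂ) := by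
    intro m
    rw [← coin_integral_exp_blocks (I m) (hIdis m), ← (hX.measurePreserving_twistedRow m).map_eq,
      integral_map (hX.measurable_twistedRow m).aemeasurable (by
        refine Measurable.aestronglyMeasurable ?_
        fun_prop)]
    refine integral_congr_ae (Eventually.of_forall fun ω => ?_)
    dsimp only
    congr 3
    refine Finset.sum_congr rfl fun i _ => ?_
    rw [stepApprox, stepApprox, walk_pad, walk_pad, Finset.sum_Ico_eq_sub _ (hmono m (hab i))]
    ring
  have hlim1 : Tendsto (fun m => ∫ ω, Complex.exp ((∑ i, e i * (stepApprox X m (b i) ω -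
      stepApprox X m (a i) ω) : ℝ) * Complex.I) ∂P) atTop (𝓝 (∫ ω, Complex.exp ((∑ i, e i *
        (limitPath X (b i) ω - limitPath X (a i) ω) : ℝ) * Complex.I) ∂P)) := by
    refine tendsto_integral_of_dominated_convergence (fun _ => 1) (fun m => ?_)
      (integrable_const 1) (fun m => Eventually.of_forall fun ω => ?_) ?_
    · have := fun t => hX.measurable_stepApprox m t
      refine Measurable.aestronglyMeasurable ?_
      fun_prop
    · rw [Complex.norm_exp_ofReal_mul_I]
    · filter_upwards [hX.ae_tendsto_stepApprox] with ω h
      have h1 : Tendsto (fun m => ∑ i, e i * (stepApprox X m (b i) ω - stepApprox X m (a i) ω)) atTop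
          (𝓝 (∑ i, e i * (limitPath X (b i) ω - limitPath X (a i) ω))) :=
        tendsto_finsetSum _ fun i _ => ((h (b i)).sub (h (a i))).const_mul (e i)
      have hcont : Continuous fun x : ℝ => Complex.exp (x * Complex.I) := by fun_prop
      exact (hcont.tendsto _).comp h1
  have hlim2 : Tendsto (fun m => ∏ i, ((Real.cos (e i * ((2 : ℝ) ^ m)⁻¹) ^ (I m i).card : ℝ) : ℂ))
      atTop (𝓝 (∏ i, ((Real.exp (-(e i ^ 2 / 2) * (b i - a i)) : ℝ) : ℂ))) := by
    refine tendsto_finsetProd _ fun i _ => ?_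
    refine (Complex.continuous_ofReal.tendsto _).comp (tendsto_cos_pow (e i) ?_)
    refine ((tendsto_floor_div (b i)).sub (tendsto_floor_div (a i))).congr fun m => ?_
    rw [Nat.card_Ico, Nat.cast_sub (hmono m (hab i)), sub_div]
  simp only [hstep] at hlim1
  exact tendsto_nhds_unique hlim1 hlim2

lemma IsSignMatrix.charFun_increment (hX : IsSignMatrix P X) {a b : ℝ≥0} (hab : a ≤ b) (e : ℝ) :
    charFun (P.map fun ω => limitPath X b ω - limitPath X a ω) e =
      ((Real.exp (-(e ^ 2 / 2) * (b - a)) : ℝ) : ℂ) := by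
  have hm : AEMeasurable (fun ω => limitPath X b ω - limitPath X a ω) P :=
    (hX.aemeasurable_limitPath b).sub (hX.aemeasurable_limitPath a)
  have h := hX.integral_exp_increments (ι := Unit) (a := fun _ => a) (b := fun _ => b)
    (fun _ => hab) (fun i j hij => absurd (Subsingleton.elim i j) hij) fun _ => e
  simp only [Finset.univ_unique, Finset.sum_singleton, Finset.prod_singleton] at h
  rw [← h, charFun_apply_real, integral_map hm (by fun_prop)]
  push_cast
  rfl

/-- The joint characteristic function is the product of the marginal ones, which are the
one-interval case of the same formula. -/
lemma IsSignMatrix.hasIndepIncrements (hX : IsSignMatrix P X) :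
    HasIndepIncrements (limitPath X) P := by
  intro n t ht
  have hm : ∀ i : Fin n, AEMeasurable
      (fun ω => limitPath X (t i.succ) ω - limitPath X (t i.castSucc) ω) P := fun i =>
    (hX.aemeasurable_limitPath _).sub (hX.aemeasurable_limitPath _)
  rw [iIndepFun_iff_charFun_pi hm]
  intro e
  have hab : ∀ i : Fin n, t i.castSucc ≤ t i.succ := fun i => ht (Fin.castSucc_le_succ i)
  have hdis : ∀ i j : Fin n, i ≠ j → t i.succ ≤ t j.castSucc ∨ t j.succ ≤ t i.castSucc := by
    intro i j hij
    rcases lt_or_gt_of_ne hij with h | h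
    · exact Or.inl (ht (by rw [Fin.le_def]; simpa using h))
    · exact Or.inr (ht (by rw [Fin.le_def]; simpa using h))
  have h := hX.integral_exp_increments hab hdis e
  simp only [hX.charFun_increment (hab _)]
  rw [← h, charFun_apply, integral_map (by fun_prop) (by fun_prop)]
  refine integral_congr_ae (Eventually.of_forall fun ω => ?_)
  simp [PiLp.inner_apply, mul_comm]

/-- The limit of the twisted and shrunk random walks is a standard Brownian motion. -/
theorem IsSignMatrix.isBrownianReal (hX : IsSignMatrix P X) :
    IsBrownianReal (limitPath X) P where
  toIsPreBrownianReal := by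
    refine HasIndepIncrements.isPreBrownianReal_of_hasLaw (fun t => ?_) hX.hasIndepIncrements
    have hm := hX.aemeasurable_limitPath t
    have := Measure.isProbabilityMeasure_map (μ := P) hm
    refine ⟨hm, Measure.ext_of_charFun ?_⟩
    funext e
    have h := hX.charFun_increment (a := 0) (b := t) zero_le e
    simp only [limitPath_zero, sub_zero] at h
    rw [charFun_gaussianReal]
    refine h.trans ?_
    push_cast
    ring_nf
  cont := hX.ae_continuous

end

end TwistShrink

theorem theorem1 :
    ∃ N₂ : ℝ → ℝ, ∀ (Ω : Type u) [MeasurableSpace Ω] (P : Measure Ω) [IsProbabilityMeasure P]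
      (X : ℕ → ℕ → Ω → ℝ), TwistShrink.IsSignMatrix P X →
      ∃ W : ℝ≥0 → Ω → ℝ,
        (∀ᵐ ω ∂P, ∀ K : ℝ≥0,
          TendstoUniformlyOn (fun (m : ℕ) (t : ℝ≥0) => TwistShrink.approx X m t ω)
            (fun t : ℝ≥0 => W t ω) Filter.atTop (Set.Iic K)) ∧
        IsBrownianReal W P ∧
        ∀ (C : ℝ), 1 < C → ∀ (K : ℝ≥0), 0 < K → ∀ (m : ℕ), 1 ≤ m →
          N₂ C ≤ (K : ℝ) * 2 ^ (2 * m) →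
          P.real {ω | 27 * C * (max 1 (K : ℝ)) ^ (1 / 4 : ℝ)
                * (TwistShrink.logStar (K : ℝ)) ^ (3 / 4 : ℝ)
                * (m : ℝ) ^ (3 / 4 : ℝ) * (2 : ℝ) ^ (-(m : ℝ) / 2)
              ≤ ⨆ t : Set.Iic K, |W (t : ℝ≥0) ω - TwistShrink.approx X m (t : ℝ≥0) ω|}
            ≤ 6 / (1 - (4 : ℝ) ^ (1 - C)) * ((K : ℝ) * 2 ^ (2 * m)) ^ (1 - C) := by
  -- The threshold depends on `C` alone and covers all larger `N`, hence every later level.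
  choose N₂ hN₂ using fun C => Filter.eventually_atTop.1 (TwistShrink.eventually_largeFor C)
  refine ⟨N₂, fun Ω _ P _ X hX => ⟨TwistShrink.limitPath X, hX.ae_tendstoUniformlyOn,
    hX.isBrownianReal, fun C hC K hK m hm hN => ?_⟩⟩
  have hlarge : ∀ j, TwistShrink.LargeFor C (TwistShrink.stepCount K (m + j)) := fun j =>
    hN₂ C _ (hN.trans (TwistShrink.stepCount_mono K (Nat.le_add_right m j)))
  have h := hX.tail_limitPath hC hK hm hlarge
  have hr1 : (4 : ℝ) ^ (1 - C) < 1 :=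
    Real.rpow_lt_one_of_one_lt_of_neg (by norm_num) (by linarith)
  have hscale : 27 * TwistShrink.errorScale C K m = 27 * C * (max 1 (K : ℝ)) ^ (1 / 4 : ℝ)
      * (TwistShrink.logStar (K : ℝ)) ^ (3 / 4 : ℝ)
      * (m : ℝ) ^ (3 / 4 : ℝ) * (2 : ℝ) ^ (-(m : ℝ) / 2) := by
    rw [TwistShrink.errorScale]
    ring
  rw [hscale] at h
  refine h.trans ?_
  rw [TwistShrink.stepCount]
  have : 0 < 1 - (4 : ℝ) ^ (1 - C) := by linarith
  gcongr
  norm_num
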